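/- **Conventions.** A ringed space is a topological space with a sheaf of (not necessarily commutative) rings; modules are left modules; a simplicial ringed space is a simplicial object $(\mathcal U,\mathcal R)=(U_n,\mathcal R_n)_{n\ge 0}$ in ringed spaces, with faces $\partial_i$ and degeneracies $s_i$, and a simplicial map is a morphism of simplicial objects. For $k\ge p$ let $\rho_{k,p}=\partial_{p+1}\circ\cdots\circ\partial_k$ and $\tau_{k,p}=\partial_0\circ\cdots\circ\partial_0$ be the front and back face maps $U_k\to U_p$. Composites of pullback functors $\alpha^*$ of sheaves of modules are identified through the canonical isomorphisms. *Twisted complexes.* For graded sheaves $E,F$ of $\mathcal R_0$-modules on $U_0$, a cochain of degree $m$ is a family $u=(u^{k,q})_{k\ge 0,\,k+q=m}$ with $u^{k,q}\in \mathrm{Hom}^{q}_{\mathcal R_k}(\tau_{k,0}^*E,\rho_{k,0}^*F)$. Put $$(\delta u)^{k+1,q}=\sum_{j=1}^{k}(-1)^j\partial_j^*u^{k,q},\quad (\delta u)^{0,q}=0,\qquad (u\cdot v)^{n,t}=\sum(-1)^{qr}(\rho_{n,p}^*u^{p,q})\circ(\tau_{n,r}^*v^{r,s}),$$ the last sum being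 over $p+r=n$, with $q=|u|-p$, $s=|v|-r$, $t=q+s$. A twisted complex on $(\mathcal U,\mathcal R)$ is a pair $(E,a)$ of a graded sheaf $E$ of $\mathcal R_0$-modules and a cochain $a=(a^{k,1-k})$ of degree $1$ from $E$ to $E$ with $\delta a+a\cdot a=0$ such that $a^{1,0}:(\tau_{1,0}^*E,\tau_{1,0}^*a^{0,1})\to(\rho_{1,0}^*E,\rho_{1,0}^*a^{0,1})$ is invertible up to homotopy. Twisted complexes form a dg-category $\mathrm{Tw}(\mathcal U,\mathcal R)$ (over $\mathbb Z$): the morphisms $(E,a)\to(F,b)$ of degree $m$ are the cochains $\theta$ of degree $m$ from $E$ to $F$, composition is $\cdot$, and $d\theta=\delta\theta+b\cdot\theta-(-1)^m\theta\cdot a$. A simplicial map $f:(\mathcal U,\mathcal R)\to(\mathcal V,\mathcal S)$ induces a dg-functor $f^*:\mathrm{Tw}(\mathcal V,\mathcal S)\to \mathrm{Tw}(\mathcal U,\mathcal R)$, $f^*(E,a)=(f_0^*E,f^*a)$, where $(f^*\phi)^{k,q}=f_k^*\phi^{k,q}$. *Homotopies.* A combinatorial simplicial homotopy $h$ between simplicial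 maps $f,g:\mathcal U\to\mathcal V$ consists of morphisms $h_i=h_i^p:U_p\to V_{p+1}$ for $p\ge 0$, $0\le i\le p$, with $\partial_0h_0=f_p$ and $\partial_{p+1}h_p=g_p$; $\partial_ih_j=h_{j-1}\partial_i$ for $i<j$, $\partial_ih_i=\partial_ih_{i-1}$ for $i\neq 0$, $\partial_ih_j=h_j\partial_{i-1}$ for $i>j+1$; $s_ih_j=h_{j+1}s_i$ for $i\le j$ and $s_ih_j=h_js_{i-1}$ for $i>j$. Then $\tau_{k+1,0}h_i=f_0\tau_{k,0}$ and $\rho_{k+1,0}h_i=g_0\rho_{k,0}$ for $0\le i\le k$. *$A_\infty$-natural transformations.* Let $F,G:\mathcal C\to\mathcal D$ be dg-functors. An $A_\infty$-prenatural transformation $\Phi:F\Rightarrow G$ of degree $n$ consists of $\Phi^0_X\in\mathcal D^n(FX,GX)$ for every object $X$ and, for $l\ge 1$ and objects $X_0,\dots,X_l$, of a linear map $\Phi^l:\mathcal C(X_{l-1},X_l)\otimes\cdots\otimes\mathcal C(X_0,X_1)\to\mathcal D(FX_0,GX_l)$ of degree $n-l$. Its differential is given by $(d^\infty\Phi)^0_X=d(\Phi^0_X)$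 and, for $l\ge 1$ and homogeneous $u_i\in\mathcal C(X_{i-1},X_i)$, $$\begin{aligned}(d^\infty\Phi)^l(u_l\otimes\cdots\otimes u_1)={}&d(\Phi^l(u_l\otimes\cdots\otimes u_1))+(-1)^{|u_l|-1}G(u_l)\,\Phi^{l-1}(u_{l-1}\otimes\cdots\otimes u_1)\\&+(-1)^{n|u_1|-|u_1|-\cdots-|u_l|+l-1}\Phi^{l-1}(u_l\otimes\cdots\otimes u_2)\,F(u_1)\\&+\sum_{i=1}^{l}(-1)^{|u_l|+\cdots+|u_{i+1}|+l-i+1}\Phi^l(u_l\otimes\cdots\otimes du_i\otimes\cdots\otimes u_1)\\&+\sum_{i=1}^{l-1}(-1)^{|u_l|+\cdots+|u_{i+1}|+l-i+1}\Phi^{l-1}(u_l\otimes\cdots\otimes u_{i+1}u_i\otimes\cdots\otimes u_1).\end{aligned}$$ $\Phi$ is an $A_\infty$-natural transformation if it is of degree $0$ and $d^\infty\Phi=0$. **Theorem.** Let $f,g:(\mathcal U,\mathcal R)\to(\mathcal V,\mathcal S)$ be simplicial maps between simplicial ringed spaces and let $h$ be a combinatorial simplicial homotopy between $f$ and $g$,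 with $\partial_0h_0=f_p$ and $\partial_{p+1}h_p=g_p$. For a twisted complex $\mathcal E=(E,a)$ on $(\mathcal V,\mathcal S)$ put $$\Phi_0(\mathcal E)^{k,-k}=\sum_{i=0}^k(-1)^ih_i^*a^{k+1,-k}\in \mathrm{Hom}^{-k}_{\mathcal R_k}(\tau_{k,0}^*f_0^*E,\rho_{k,0}^*g_0^*E)\qquad(k\ge 0),$$ and for a morphism $\phi:(E,a)\to(F,b)$ of degree $m$ in $\mathrm{Tw}(\mathcal V,\mathcal S)$ put $$\Phi_1(\phi)^{k,m-k-1}=(-1)^{m-1}\sum_{i=0}^k(-1)^ih_i^*\phi^{k+1,m-k-1}\in \mathrm{Hom}^{m-k-1}_{\mathcal R_k}(\tau_{k,0}^*f_0^*E,\rho_{k,0}^*g_0^*F)\qquad(k\ge 0).$$ Then $\Phi=\{\Phi_0,\Phi_1,0,0,\dots\}$ is an $A_\infty$-natural transformation from $f^*$ to $g^*$, as dg-functors $\mathrm{Tw}(\mathcal V,\mathcal S)\to\mathrm{Tw}(\mathcal U,\mathcal R)$. -/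

import Mathlib

open CategoryTheory AlgebraicGeometry TopologicalSpace Opposite
open scoped Simplicial

universe u

noncomputable section

namespace TwistedComplex

/-- Ringed spaces: a topological space with a sheaf of (not necessarily commutative) rings. -/
abbrev RingedSp := SheafedSpace.{u+1,u,u} RingCat.{u}

/-- The structure sheaf, as a sheaf on the site of open subsets. -/
def strSheaf (X : RingedSp.{u}) : CategoryTheory.Sheaf (Opens.grothendieckTopology (X : TopCat.{u})) RingCat.{u} :=
  ⟨X.presheaf, X.IsSheaf⟩

/-- Sheaves of (left) modules over the structure sheaf. -/
abbrev Mod (X : RingedSp.{u}) := SheafOfModules.{u} (strSheaf X)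

/-- The morphism of sheaves of rings `𝒪_Y ⟶ f_* 𝒪_X` underlying `f : X ⟶ Y`. -/
def ringHom {X Y : RingedSp.{u}} (f : X ⟶ Y) :
    strSheaf Y ⟶ ((Opens.map f.hom.base).sheafPushforwardContinuous RingCat.{u}
      (Opens.grothendieckTopology (Y : TopCat.{u})) (Opens.grothendieckTopology (X : TopCat.{u}))).obj (strSheaf X) := ⟨f.hom.c⟩

/-- The direct image of sheaves of modules. -/
def push {X Y : RingedSp.{u}} (f : X ⟶ Y) : Mod X ⥤ Mod Y := SheafOfModules.pushforward.{u} (ringHom f)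
instance {X Y : RingedSp.{u}} (f : X ⟶ Y) : (PresheafOfModules.pushforward.{u} (ringHom f).hom).IsRightAdjoint :=
  inferInstanceAs ((PresheafOfModules.pushforward.{u} (F := Opens.map f.hom.base)
    (R := X.presheaf) (S := Y.presheaf) f.hom.c).IsRightAdjoint)
instance {X Y : RingedSp.{u}} (f : X ⟶ Y) : (SheafOfModules.pushforward.{u} (ringHom f)).IsRightAdjoint := by
  infer_instance

/-- The inverse image `f^*` of sheaves of modules, left adjoint of `f_*`. -/
def pull {X Y : RingedSp.{u}} (f : X ⟶ Y) : Mod Y ⥤ Mod X := SheafOfModules.pullback.{u} (ringHom f)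
/-- The adjunction between `f^*` and `f_*`. -/
def adj {X Y : RingedSp.{u}} (f : X ⟶ Y) : pull f ⊣ push f := SheafOfModules.pullbackPushforwardAdjunction.{u} (ringHom f)
instance {X : RingedSp.{u}} : Preadditive (Mod X) := inferInstance
instance {X Y : RingedSp.{u}} (f : X ⟶ Y) : (push f).Additive where
  map_add := rfl
instance {X Y : RingedSp.{u}} (f : X ⟶ Y) : (pull f).Additive := (adj f).left_adjoint_additive

/-- The canonical isomorphism `id^* ≅ id`. -/
def pullId (X : RingedSp.{u}) : pull (𝟙 X) ≅ 𝟭 _ := SheafOfModules.pullbackId (strSheaf X)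
/-- The canonical isomorphism `f^* g^* ≅ (g ∘ f)^*`. (`f ≫ g` is `g ∘ f`.) -/
def pullComp {X Y Z : RingedSp.{u}} (f : X ⟶ Y) (g : Y ⟶ Z) : pull g ⋙ pull f ≅ pull (f ≫ g) := SheafOfModules.pullbackComp (ringHom g) (ringHom f)

theorem pullComp_assoc {X Y Z W : RingedSp.{u}} (f : X ⟶ Y) (g : Y ⟶ Z) (h : Z ⟶ W) (M : Mod W) :
    (pull f).map ((pullComp g h).hom.app M) ≫ (pullComp f (g ≫ h)).hom.app M =
      (pullComp f g).hom.app ((pull h).obj M) ≫ (pullComp (f ≫ g) h).hom.app M := by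
  have := congr_arg (fun e => e.hom.app M)
    (SheafOfModules.pullback_assoc.{u} (ringHom h) (ringHom g) (ringHom f))
  exact (Category.id_comp _).symm.trans this.symm

theorem pullComp_id {X Y : RingedSp.{u}} (f : X ⟶ Y) (M : Mod Y) :
    (pullComp (𝟙 X) f).hom.app M = (pullId X).hom.app ((pull f).obj M) := by
  have := congr_arg (fun e => e.hom.app M)
    (SheafOfModules.pullback_comp_id.{u} (ringHom f))
  refine this.trans ?_
  exact Category.comp_id _

variable {X X' X'' Y A B A' B' Z : RingedSp.{u}}

theorem comp_eqToHom_assoc {X Y Z W : RingedSp.{u}} (f : X ⟶ Y) (g : Y ⟶ Z) (h : Z ⟶ W) (M : Mod W)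
    (e : (pull ((f ≫ g) ≫ h)).obj M = (pull (f ≫ g ≫ h)).obj M) {N : Mod X}
    (v : N ⟶ (pull ((f ≫ g) ≫ h)).obj M) : v ≫ eqToHom e = v :=
  Category.comp_id v

/-- The canonical isomorphism `f^* g^* M ≅ k^* M` when `k = g ∘ f`. -/
def pullIso (f : X ⟶ Y) (g : Y ⟶ Z) (k : X ⟶ Z) (hk : f ≫ g = k) (M : Mod Z) :
    (pull f).obj ((pull g).obj M) ≅ (pull k).obj M :=
  (pullComp f g).app M ≪≫ eqToIso (by rw [hk])

theorem pullIso_naturality (f : X ⟶ Y) (g : Y ⟶ Z) (k : X ⟶ Z) (hk : f ≫ g = k) {M N : Mod Z}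
    (u : M ⟶ N) :
    (pullIso f g k hk M).hom ≫ (pull k).map u =
      (pull f).map ((pull g).map u) ≫ (pullIso f g k hk N).hom := by
  subst hk
  simpa [pullIso] using ((pullComp f g).hom.naturality u).symm

theorem pullIso_assoc {X Y Z W : RingedSp.{u}} (f : X ⟶ Y) (g : Y ⟶ Z) (h : Z ⟶ W)
    (fg : X ⟶ Z) (gh : Y ⟶ W) (k : X ⟶ W) (h₁ : f ≫ g = fg) (h₂ : g ≫ h = gh)
    (h₃ : f ≫ gh = k) (h₄ : fg ≫ h = k) (M : Mod W) :
    (pull f).map (pullIso g h gh h₂ M).hom ≫ (pullIso f gh k h₃ M).hom =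
      (pullIso f g fg h₁ ((pull h).obj M)).hom ≫ (pullIso fg h k h₄ M).hom := by
  subst h₁ h₂ h₃
  simp only [pullIso, Iso.trans_hom, eqToIso.hom, Iso.app_hom, eqToHom_refl, Category.comp_id]
  rw [pullComp_assoc f g h M]
  exact congrArg ((pullComp f g).hom.app ((pull h).obj M) ≫ ·) (comp_eqToHom_assoc f g h M _ _).symm

theorem pullIso_id (f : X ⟶ Y) (h : 𝟙 X ≫ f = f) (M : Mod Y) :
    (pullIso (𝟙 X) f f h M).hom = (pullId X).hom.app ((pull f).obj M) := by
  refine Eq.trans ?_ (pullComp_id f M)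
  exact Category.comp_id _

/-- The pullback `α^* u : a'^* M ⟶ b'^* N` of a morphism `u : a^* M ⟶ b^* N` of modules along
`α`, where `a' = a ∘ α` and `b' = b ∘ α`. The composites `α^* a^*` and `(a ∘ α)^*` are identified
through the canonical isomorphisms. -/
def res {a : Y ⟶ A} {b : Y ⟶ B} {M : Mod A} {N : Mod B} (α : X ⟶ Y) {a' : X ⟶ A} {b' : X ⟶ B}
    (ha : α ≫ a = a') (hb : α ≫ b = b') (u : (pull a).obj M ⟶ (pull b).obj N) :
    (pull a').obj M ⟶ (pull b').obj N :=
  (pullIso α a a' ha M).inv ≫ (pull α).map u ≫ (pullIso α b b' hb N).hom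

section
variable {a : Y ⟶ A} {b : Y ⟶ B} {M : Mod A} {N : Mod B} {α : X ⟶ Y} {a' : X ⟶ A} {b' : X ⟶ B}
    (ha : α ≫ a = a') (hb : α ≫ b = b')

theorem res_add (u v : (pull a).obj M ⟶ (pull b).obj N) :
    res α ha hb (u + v) = res α ha hb u + res α ha hb v := by
  simp [res, Functor.map_add]

theorem res_comp {C : RingedSp.{u}} {c : Y ⟶ C} {c' : X ⟶ C} (hc : α ≫ c = c') {P : Mod C}
    (u : (pull a).obj M ⟶ (pull b).obj N) (v : (pull b).obj N ⟶ (pull c).obj P) :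
    res α ha hc (u ≫ v) = res α ha hb u ≫ res α hb hc v := by
  simp [res]

theorem res_one : res α ha ha (𝟙 ((pull a).obj M)) = 𝟙 _ := by
  simp [res]

end

theorem res_id {a : X ⟶ A} {b : X ⟶ B} {M : Mod A} {N : Mod B} {α : X ⟶ X} (h : α = 𝟙 X)
    (ha : α ≫ a = a) (hb : α ≫ b = b) (u : (pull a).obj M ⟶ (pull b).obj N) :
    res α ha hb u = u := by
  subst h
  rw [res, Iso.inv_comp_eq, pullIso_id, pullIso_id]
  exact (pullId X).hom.naturality u

theorem res_res {a : Y ⟶ A} {b : Y ⟶ B} {M : Mod A} {N : Mod B} {α : X ⟶ Y} {β : X' ⟶ X}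
    {γ : X' ⟶ Y} (hγ : β ≫ α = γ)
    {a' : X ⟶ A} {b' : X ⟶ B} {a'' : X' ⟶ A} {b'' : X' ⟶ B}
    (ha : α ≫ a = a') (hb : α ≫ b = b') (ha' : β ≫ a' = a'') (hb' : β ≫ b' = b'')
    (ha'' : γ ≫ a = a'') (hb'' : γ ≫ b = b'')
    (u : (pull a).obj M ⟶ (pull b).obj N) :
    res β ha' hb' (res α ha hb u) = res γ ha'' hb'' u := by
  have e1 := pullIso_assoc β α a γ a' a'' hγ ha ha' ha'' M
  have e2 := pullIso_assoc β α b γ b' b'' hγ hb hb' hb'' N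
  have e1' : (pullIso β a' a'' ha' M).inv ≫ (pull β).map (pullIso α a a' ha M).inv =
      (pullIso γ a a'' ha'' M).inv ≫ (pullIso β α γ hγ _).inv := by
    rw [Iso.inv_comp_eq, ← Category.assoc, Iso.eq_comp_inv, Iso.eq_comp_inv, Category.assoc, ← e1,
      ← Category.assoc, ← Functor.map_comp]
    simp
  simp only [res, Functor.map_comp, Category.assoc, e2]
  rw [reassoc_of% e1', ← reassoc_of% (pullIso_naturality β α γ hγ u)]
  simp

/-- The pullback `α^* u : a'^* f^* M ⟶ b'^* g^* N` of a morphism `u : a^* M ⟶ b^* N` of modules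
along `α`, where `a ∘ α = f ∘ a'` and `b ∘ α = g ∘ b'`; again all composites of pullback functors
are identified through the canonical isomorphisms. -/
def sq {a : Y ⟶ A} {b : Y ⟶ B} {M : Mod A} {N : Mod B} (α : X ⟶ Y) {f : A' ⟶ A} {g : B' ⟶ B}
    {a' : X ⟶ A'} {b' : X ⟶ B'} (ha : α ≫ a = a' ≫ f) (hb : α ≫ b = b' ≫ g)
    (u : (pull a).obj M ⟶ (pull b).obj N) :
    (pull a').obj ((pull f).obj M) ⟶ (pull b').obj ((pull g).obj N) :=
  (pullIso a' f _ rfl M).hom ≫ res α ha hb u ≫ (pullIso b' g _ rfl N).inv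

theorem res_pullIso {f : A' ⟶ A} {M : Mod A} {a : X ⟶ A'} {b : X ⟶ A} (h : a ≫ f = b) {β : X' ⟶ X}
    {a' : X' ⟶ A'} {b' : X' ⟶ A} (ha : β ≫ a = a') (hb : β ≫ b = b') (h' : a' ≫ f = b') :
    res β ha hb (pullIso a f b h M).hom = (pullIso a' f b' h' M).hom := by
  rw [res, pullIso_assoc β a f a' b b' ha h hb h' M]; simp
theorem res_pullIso_inv {f : A' ⟶ A} {M : Mod A} {a : X ⟶ A'} {b : X ⟶ A} (h : a ≫ f = b)
    {β : X' ⟶ X}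
    {a' : X' ⟶ A'} {b' : X' ⟶ A} (ha : β ≫ a = a') (hb : β ≫ b = b') (h' : a' ≫ f = b') :
    res β hb ha (pullIso a f b h M).inv = (pullIso a' f b' h' M).inv := by
  rw [← cancel_epi (pullIso a' f b' h' M).hom, Iso.hom_inv_id, ← res_pullIso h ha hb h',
    ← res_comp, Iso.hom_inv_id, res_one]

section
variable {a : Y ⟶ A} {b : Y ⟶ B} {M : Mod A} {N : Mod B}

theorem sq_add {α : X ⟶ Y} {f : A' ⟶ A} {g : B' ⟶ B}
    {a' : X ⟶ A'} {b' : X ⟶ B'} (ha : α ≫ a = a' ≫ f) (hb : α ≫ b = b' ≫ g)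
    (u v : (pull a).obj M ⟶ (pull b).obj N) :
    sq α ha hb (u + v) = sq α ha hb u + sq α ha hb v := by
  simp [sq, res_add]

theorem sq_comp {C C' : RingedSp.{u}} {c : Y ⟶ C} {P : Mod C}
    {α : X ⟶ Y} {f : A' ⟶ A} {g : B' ⟶ B} {h : C' ⟶ C}
    {a' : X ⟶ A'} {b' : X ⟶ B'} {c' : X ⟶ C'}
    (ha : α ≫ a = a' ≫ f) (hb : α ≫ b = b' ≫ g) (hc : α ≫ c = c' ≫ h)
    (u : (pull a).obj M ⟶ (pull b).obj N) (v : (pull b).obj N ⟶ (pull c).obj P) :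
    sq α ha hc (u ≫ v) = sq α ha hb u ≫ sq α hb hc v := by
  simp [sq, res_comp ha hb hc]

theorem sq_one {α : X ⟶ Y} {f : A' ⟶ A} {a' : X ⟶ A'} (ha : α ≫ a = a' ≫ f) :
    sq α ha ha (𝟙 ((pull a).obj M)) = 𝟙 _ := by
  simp [sq, res_one]

theorem res_sq {α : X ⟶ Y} {f : A' ⟶ A} {g : B' ⟶ B}
    {a' : X ⟶ A'} {b' : X ⟶ B'} (ha : α ≫ a = a' ≫ f) (hb : α ≫ b = b' ≫ g)
    {β : X' ⟶ X} {a'' : X' ⟶ A'} {b'' : X' ⟶ B'} (ha' : β ≫ a' = a'') (hb' : β ≫ b' = b'')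
    {γ : X' ⟶ Y} (hγ : β ≫ α = γ) (ha'' : γ ≫ a = a'' ≫ f) (hb'' : γ ≫ b = b'' ≫ g)
    (u : (pull a).obj M ⟶ (pull b).obj N) :
    res β ha' hb' (sq α ha hb u) = sq γ ha'' hb'' u := by
  have h1 : β ≫ a' ≫ f = a'' ≫ f := by rw [← Category.assoc, ha']
  have h2 : β ≫ b' ≫ g = b'' ≫ g := by rw [← Category.assoc, hb']
  rw [sq, res_comp (b := a' ≫ f) (b' := a'' ≫ f) ha' h1 hb',
    res_comp (b := b' ≫ g) (b' := b'' ≫ g) h1 h2 hb',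
    res_pullIso rfl ha' h1 rfl, res_pullIso_inv rfl hb' h2 rfl,
    res_res hγ ha hb h1 h2 ha'' hb'']
  rfl

theorem sq_res {Z : RingedSp.{u}} {θ : Y ⟶ Z} {a₀ : Z ⟶ A} {b₀ : Z ⟶ B}
    (h₁ : θ ≫ a₀ = a) (h₂ : θ ≫ b₀ = b) {α : X ⟶ Y} {f : A' ⟶ A} {g : B' ⟶ B}
    {a' : X ⟶ A'} {b' : X ⟶ B'} (ha : α ≫ a = a' ≫ f) (hb : α ≫ b = b' ≫ g)
    {γ : X ⟶ Z} (hγ : α ≫ θ = γ) (ha'' : γ ≫ a₀ = a' ≫ f) (hb'' : γ ≫ b₀ = b' ≫ g)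
    (u : (pull a₀).obj M ⟶ (pull b₀).obj N) :
    sq α ha hb (res θ h₁ h₂ u) = sq γ ha'' hb'' u := by
  rw [sq, res_res hγ h₁ h₂ ha hb ha'' hb'']
  rfl
end

end TwistedComplex

namespace TwistedComplex

/-- Graded sheaves of modules. -/
abbrev GMod (X : RingedSp.{u}) := ℤ → Mod X

/-- The degreewise pullback of a graded sheaf of modules. -/
def gpull {X Y : RingedSp.{u}} (f : X ⟶ Y) (E : GMod Y) : GMod X := fun i => (pull f).obj (E i)

/-- A source degree and a target degree that differ by `q`. -/
structure Deg (q : ℤ) where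
  src : ℤ
  tgt : ℤ
  eq : src + q = tgt

/-- `Hom^q(E, F)`: families of morphisms `E^i ⟶ F^{i+q}`, one for each `i`. -/
def GHom {X : RingedSp.{u}} (E F : GMod X) (q : ℤ) : Type u := ∀ x : Deg q, E x.src ⟶ F x.tgt

namespace GHom
variable {X : RingedSp.{u}} {E F G K : GMod X}

instance (q : ℤ) : AddCommGroup (GHom E F q) :=
  inferInstanceAs (AddCommGroup (∀ x : Deg q, E x.src ⟶ F x.tgt))

protected theorem ext {q : ℤ} {u v : GHom E F q} (h : ∀ i j hij, u ⟨i, j, hij⟩ = v ⟨i, j, hij⟩) :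
    u = v := by
  funext ⟨i, j, hij⟩; exact h i j hij

@[simp] theorem add_apply {q : ℤ} (u v : GHom E F q) (i j : ℤ) (h : i + q = j) :
    (u + v) ⟨i, j, h⟩ = u ⟨i, j, h⟩ + v ⟨i, j, h⟩ := rfl

/-- The identity, of degree `0`. -/
protected def id (E : GMod X) : GHom E E 0 := fun x =>
  eqToHom (congrArg E ((add_zero x.src).symm.trans x.eq))

/-- The composite `u ∘ v` of degreewise morphisms, without sign. -/
def comp {q s t : ℤ} (u : GHom F G q) (v : GHom E F s) (h : q + s = t) : GHom E G t :=
  fun x => v ⟨x.src, x.src + s, rfl⟩ ≫ u ⟨x.src + s, x.tgt, by have := x.eq; omega⟩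

theorem comp_apply {q s t : ℤ} (u : GHom F G q) (v : GHom E F s) (h : q + s = t) (i k j : ℤ)
    (hij : i + t = j) (hik : i + s = k) (hkj : k + q = j) :
    u.comp v h ⟨i, j, hij⟩ = v ⟨i, k, hik⟩ ≫ u ⟨k, j, hkj⟩ := by
  subst hik; rfl

theorem comp_assoc {q r s qr rs t : ℤ} (u : GHom G K q) (v : GHom F G r) (w : GHom E F s)
    (h₁ : q + r = qr) (h₂ : qr + s = t) (h₃ : r + s = rs) (h₄ : q + rs = t) :
    (u.comp v h₁).comp w h₂ = u.comp (v.comp w h₃) h₄ := by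
  refine GHom.ext fun i j hij => ?_
  rw [comp_apply _ _ h₂ i (i + s) j hij rfl (by omega),
    comp_apply _ _ h₁ (i + s) (i + s + r) j (by omega) rfl (by omega),
    comp_apply _ _ h₄ i (i + s + r) j hij (by omega) (by omega),
    comp_apply _ _ h₃ i (i + s) (i + s + r) (by omega) rfl (by omega), Category.assoc]

theorem id_comp {q : ℤ} (u : GHom E F q) (h : 0 + q = q) : (GHom.id F).comp u h = u := by
  refine GHom.ext fun i j hij => ?_
  subst hij
  rw [comp_apply _ _ h i (i + q) (i + q) rfl rfl (by omega)]
  simp [GHom.id]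

theorem comp_id {q : ℤ} (u : GHom E F q) (h : q + 0 = q) : u.comp (GHom.id E) h = u := by
  refine GHom.ext fun i j hij => ?_
  rw [comp_apply _ _ h i i j hij (by omega) hij]
  simp [GHom.id]

theorem add_comp {q s t : ℤ} (u u' : GHom F G q) (v : GHom E F s) (h : q + s = t) :
    (u + u').comp v h = u.comp v h + u'.comp v h := by
  refine GHom.ext fun i j hij => ?_; simp [comp]

theorem comp_add {q s t : ℤ} (u : GHom F G q) (v v' : GHom E F s) (h : q + s = t) :
    u.comp (v + v') h = u.comp v h + u.comp v' h := by
  refine GHom.ext fun i j hij => ?_; simp [comp]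

/-- Composition as a biadditive map. -/
def compHom {q s t : ℤ} (h : q + s = t) : GHom F G q →+ GHom E F s →+ GHom E G t :=
  AddMonoidHom.mk' (fun u => AddMonoidHom.mk' (fun v => u.comp v h) fun v v' => comp_add u v v' h)
    fun u u' => by ext v : 1; exact add_comp u u' v h

end GHom

variable {X X' Y Z A B C A' B' C' : RingedSp.{u}}

/-- Degreewise version of `res`. -/
def gres {a : Y ⟶ A} {b : Y ⟶ B} {E : GMod A} {F : GMod B} {q : ℤ} (α : X ⟶ Y) {a' : X ⟶ A}
    {b' : X ⟶ B} (ha : α ≫ a = a') (hb : α ≫ b = b') :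
    GHom (gpull a E) (gpull b F) q →+ GHom (gpull a' E) (gpull b' F) q :=
  AddMonoidHom.mk' (fun u x => res α ha hb (u x)) fun u v => by
    funext x; exact res_add ha hb _ _

/-- Degreewise version of `sq`. -/
def gsq {a : Y ⟶ A} {b : Y ⟶ B} {E : GMod A} {F : GMod B} {q : ℤ} (α : X ⟶ Y)
    {f : A' ⟶ A} {g : B' ⟶ B} {a' : X ⟶ A'} {b' : X ⟶ B'}
    (ha : α ≫ a = a' ≫ f) (hb : α ≫ b = b' ≫ g) :
    GHom (gpull a E) (gpull b F) q →+ GHom (gpull a' (gpull f E)) (gpull b' (gpull g F)) q :=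
  AddMonoidHom.mk' (fun u x => sq α ha hb (u x)) fun u v => by
    funext x; exact sq_add ha hb _ _

section
variable {a : Y ⟶ A} {b : Y ⟶ B} {c : Y ⟶ C} {E : GMod A} {F : GMod B} {G : GMod C} {q s t : ℤ}

theorem gres_comp {α : X ⟶ Y} {a' : X ⟶ A} {b' : X ⟶ B} {c' : X ⟶ C}
    (ha : α ≫ a = a') (hb : α ≫ b = b') (hc : α ≫ c = c')
    (u : GHom (gpull b F) (gpull c G) q) (v : GHom (gpull a E) (gpull b F) s) (h : q + s = t) :
    gres α ha hc (u.comp v h) = (gres α hb hc u).comp (gres α ha hb v) h := by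
  refine GHom.ext fun i j hij => ?_; exact res_comp ha hb hc _ _

theorem gres_one {α : X ⟶ Y} {a' : X ⟶ A} (ha : α ≫ a = a') :
    gres α ha ha (GHom.id (gpull a E)) = GHom.id (gpull a' E) := by
  refine GHom.ext fun i j hij => ?_
  obtain rfl : i = j := by omega
  exact res_one ha

theorem gres_id {α : Y ⟶ Y} (h : α = 𝟙 Y) (ha : α ≫ a = a) (hb : α ≫ b = b)
    (u : GHom (gpull a E) (gpull b F) q) : gres α ha hb u = u := by
  refine GHom.ext fun i j hij => ?_; exact res_id h ha hb _

theorem gres_gres {α : X ⟶ Y} {β : X' ⟶ X} {γ : X' ⟶ Y} (hγ : β ≫ α = γ)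
    {a' : X ⟶ A} {b' : X ⟶ B} {a'' : X' ⟶ A} {b'' : X' ⟶ B}
    (ha : α ≫ a = a') (hb : α ≫ b = b') (ha' : β ≫ a' = a'') (hb' : β ≫ b' = b'')
    (ha'' : γ ≫ a = a'') (hb'' : γ ≫ b = b'') (u : GHom (gpull a E) (gpull b F) q) :
    gres β ha' hb' (gres α ha hb u) = gres γ ha'' hb'' u := by
  refine GHom.ext fun i j hij => ?_; exact res_res hγ ha hb ha' hb' ha'' hb'' _

theorem gsq_comp {α : X ⟶ Y} {f : A' ⟶ A} {g : B' ⟶ B} {k : C' ⟶ C}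
    {a' : X ⟶ A'} {b' : X ⟶ B'} {c' : X ⟶ C'}
    (ha : α ≫ a = a' ≫ f) (hb : α ≫ b = b' ≫ g) (hc : α ≫ c = c' ≫ k)
    (u : GHom (gpull b F) (gpull c G) q) (v : GHom (gpull a E) (gpull b F) s) (h : q + s = t) :
    gsq α ha hc (u.comp v h) = (gsq α hb hc u).comp (gsq α ha hb v) h := by
  refine GHom.ext fun i j hij => ?_; exact sq_comp ha hb hc _ _

theorem gsq_one {α : X ⟶ Y} {f : A' ⟶ A} {a' : X ⟶ A'} (ha : α ≫ a = a' ≫ f) :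
    gsq α ha ha (GHom.id (gpull a E)) = GHom.id (gpull a' (gpull f E)) := by
  refine GHom.ext fun i j hij => ?_
  obtain rfl : i = j := by omega
  exact sq_one ha

theorem gres_gsq {α : X ⟶ Y} {f : A' ⟶ A} {g : B' ⟶ B}
    {a' : X ⟶ A'} {b' : X ⟶ B'} (ha : α ≫ a = a' ≫ f) (hb : α ≫ b = b' ≫ g)
    {β : X' ⟶ X} {a'' : X' ⟶ A'} {b'' : X' ⟶ B'} (ha' : β ≫ a' = a'') (hb' : β ≫ b' = b'')
    {γ : X' ⟶ Y} (hγ : β ≫ α = γ) (ha'' : γ ≫ a = a'' ≫ f) (hb'' : γ ≫ b = b'' ≫ g)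
    (u : GHom (gpull a E) (gpull b F) q) :
    gres β ha' hb' (gsq α ha hb u) = gsq γ ha'' hb'' u := by
  refine GHom.ext fun i j hij => ?_; exact res_sq ha hb ha' hb' hγ ha'' hb'' _

theorem gsq_gres {θ : Y ⟶ Z} {a₀ : Z ⟶ A} {b₀ : Z ⟶ B}
    (h₁ : θ ≫ a₀ = a) (h₂ : θ ≫ b₀ = b) {α : X ⟶ Y} {f : A' ⟶ A} {g : B' ⟶ B}
    {a' : X ⟶ A'} {b' : X ⟶ B'} (ha : α ≫ a = a' ≫ f) (hb : α ≫ b = b' ≫ g)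
    {γ : X ⟶ Z} (hγ : α ≫ θ = γ) (ha'' : γ ≫ a₀ = a' ≫ f) (hb'' : γ ≫ b₀ = b' ≫ g)
    (u : GHom (gpull a₀ E) (gpull b₀ F) q) :
    gsq α ha hb (gres θ h₁ h₂ u) = gsq γ ha'' hb'' u := by
  refine GHom.ext fun i j hij => ?_; exact sq_res h₁ h₂ ha hb hγ ha'' hb'' _
end

/-- `u : (E, dE) → (F, dF)` is invertible up to homotopy: there is a morphism `v` of complexes in
the other direction such that `v ∘ u` and `u ∘ v` are homotopic to the identities. -/
def InvertibleUpToHomotopy {X : RingedSp.{u}} {E F : GMod X} (dE : GHom E E 1) (dF : GHom F F 1)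
    (u : GHom E F 0) : Prop :=
  ∃ v : GHom F E 0, dE.comp v (add_zero 1) = v.comp dF (zero_add 1) ∧
    (∃ s : GHom E E (-1), v.comp u (add_zero 0) - GHom.id E =
      dE.comp s (by norm_num : (1 : ℤ) + -1 = 0) + s.comp dE (by norm_num)) ∧
    (∃ s : GHom F F (-1), u.comp v (add_zero 0) - GHom.id F =
      dF.comp s (by norm_num : (1 : ℤ) + -1 = 0) + s.comp dF (by norm_num))

theorem InvertibleUpToHomotopy.gsq {a : Y ⟶ A} {b : Y ⟶ B} {E : GMod A} {F : GMod B}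
    {dE : GHom (gpull a E) (gpull a E) 1} {dF : GHom (gpull b F) (gpull b F) 1}
    {w : GHom (gpull a E) (gpull b F) 0} (hw : InvertibleUpToHomotopy dE dF w)
    {α : X ⟶ Y} {f : A' ⟶ A} {g : B' ⟶ B} {a' : X ⟶ A'} {b' : X ⟶ B'}
    (ha : α ≫ a = a' ≫ f) (hb : α ≫ b = b' ≫ g) :
    InvertibleUpToHomotopy (TwistedComplex.gsq α ha ha dE) (TwistedComplex.gsq α hb hb dF) (TwistedComplex.gsq α ha hb w) := by
  obtain ⟨v, hv, ⟨s, hs⟩, ⟨t, ht⟩⟩ := hw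
  refine ⟨TwistedComplex.gsq α hb ha v, ?_, ⟨TwistedComplex.gsq α ha ha s, ?_⟩, ⟨TwistedComplex.gsq α hb hb t, ?_⟩⟩
  · rw [← gsq_comp hb ha ha, hv, gsq_comp hb hb ha]
  · rw [← gsq_comp ha hb ha, ← gsq_one ha, ← map_sub, hs, map_add, gsq_comp ha ha ha,
      gsq_comp ha ha ha]
  · rw [← gsq_comp hb ha hb, ← gsq_one hb, ← map_sub, ht, map_add, gsq_comp hb hb hb,
      gsq_comp hb hb hb]

end TwistedComplex

namespace TwistedComplex

/-- The sign `(-1)^x`. -/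
def sgn (x : ℤ) : ℤ := (Int.negOnePow x : ℤˣ)

theorem sgn_add (x y : ℤ) : sgn (x + y) = sgn x * sgn y := by simp [sgn, Int.negOnePow_add]
theorem sgn_mul_self (x : ℤ) : sgn x * sgn x = 1 := by 
  rw [← sgn_add, sgn, Int.negOnePow_even _ (by simp), Units.val_one]
theorem sgn_zero : sgn 0 = 1 := by simp [sgn]
theorem sgn_one : sgn 1 = -1 := by simp [sgn]
theorem sgn_congr {x y : ℤ} (h : Even (x - y)) : sgn x = sgn y := by
  rw [sgn, sgn, (Int.negOnePow_eq_iff x y).2 h]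

/-- The inclusion `i ↦ i` of the first `p + 1` vertices. -/
def front {p n : ℕ} (h : p ≤ n) : ⦋p⦌ ⟶ ⦋n⦌ :=
  SimplexCategory.mkHom ⟨fun i => ⟨i, by omega⟩, fun _ _ h => h⟩

/-- The inclusion `i ↦ (n - r) + i` of the last `r + 1` vertices. -/
def back {r n : ℕ} (h : r ≤ n) : ⦋r⦌ ⟶ ⦋n⦌ :=
  SimplexCategory.mkHom ⟨fun i => ⟨(n - r) + i, by omega⟩, fun i j h => by
    simpa using h⟩

section
variable {C : Type*} [Category C] (U : SimplicialObject C)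

/-- The front face map `ρ_{k,p}`; it is the iterated face `∂_{p+1} ∘ ⋯ ∘ ∂_k`, see `rho_self` and
`rho_succ`. -/
def rho {k p : ℕ} (h : p ≤ k) : U _⦋k⦌ ⟶ U _⦋p⦌ := U.map (front h).op
/-- The back face map `τ_{k,p}`; it is the iterated face `∂_0 ∘ ⋯ ∘ ∂_0`, see `tau_self` and
`tau_succ`. -/
def tau {k p : ℕ} (h : p ≤ k) : U _⦋k⦌ ⟶ U _⦋p⦌ := U.map (back h).op

theorem map_eq_map {k p : ℕ} {θ θ' : ⦋p⦌ ⟶ ⦋k⦌} (h : ∀ i : Fin (p + 1), (θ i : ℕ) = θ' i) :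
    U.map θ.op = U.map θ'.op := by
  have : θ = θ' := by ext i; exact h i
  rw [this]

theorem comp_eq_comp {n k l p : ℕ} {α : ⦋k⦌ ⟶ ⦋n⦌} {β : ⦋p⦌ ⟶ ⦋k⦌} {γ : ⦋l⦌ ⟶ ⦋n⦌} {ε : ⦋p⦌ ⟶ ⦋l⦌}
    (h : ∀ i : Fin (p + 1), (α (β i) : ℕ) = γ (ε i)) :
    U.map α.op ≫ U.map β.op = U.map γ.op ≫ U.map ε.op := by
  rw [← U.map_comp, ← U.map_comp, ← op_comp, ← op_comp]
  exact map_eq_map U h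

theorem comp_eq_map {n k p : ℕ} {α : ⦋k⦌ ⟶ ⦋n⦌} {β : ⦋p⦌ ⟶ ⦋k⦌} {γ : ⦋p⦌ ⟶ ⦋n⦌}
    (h : ∀ i : Fin (p + 1), (α (β i) : ℕ) = γ i) :
    U.map α.op ≫ U.map β.op = U.map γ.op := by
  rw [← U.map_comp, ← op_comp]
  exact map_eq_map U h

theorem front_apply {p n : ℕ} (h : p ≤ n) (i : Fin (p + 1)) : (front h i : ℕ) = i := rfl
theorem back_apply {p n : ℕ} (h : p ≤ n) (i : Fin (p + 1)) : (back h i : ℕ) = (n - p) + i := rfl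
theorem delta_apply {n : ℕ} (j : Fin (n + 2)) (i : Fin (n + 1)) :
    (SimplexCategory.δ j i : ℕ) = if (i : ℕ) < j then (i : ℕ) else i + 1 := by
  change ((j.succAbove i : Fin (n + 2)) : ℕ) = _
  simp only [Fin.succAbove, Fin.lt_def, Fin.val_castSucc]
  split_ifs <;> rfl

theorem rho_rho {k p r : ℕ} (h : p ≤ k) (h' : r ≤ p) : rho U h ≫ rho U h' = rho U (h'.trans h) :=
  comp_eq_map U fun _ => rfl

theorem tau_tau {k p r : ℕ} (h : p ≤ k) (h' : r ≤ p) : tau U h ≫ tau U h' = tau U (h'.trans h) :=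
  comp_eq_map U fun i => by simp only [back_apply]; omega

theorem tau_rho {k p r s : ℕ} (h : p ≤ k) (h' : r ≤ p) (hs : s ≤ k) (hr : r ≤ s)
    (e : s + p = k + r) : tau U h ≫ rho U h' = rho U hs ≫ tau U hr :=
  comp_eq_comp U fun i => by simp only [back_apply, front_apply]; omega

theorem rho_self {k : ℕ} (h : k ≤ k) : rho U h = 𝟙 _ := by
  rw [← U.map_id, ← op_id]; exact map_eq_map U fun i => rfl

theorem tau_self {k : ℕ} (h : k ≤ k) : tau U h = 𝟙 _ := by
  rw [← U.map_id, ← op_id]; exact map_eq_map U fun i => by simp only [back_apply]; simp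

theorem rho_succ {k p : ℕ} (h : p ≤ k) :
    rho U (Nat.le_succ_of_le h) = U.δ (Fin.last (k + 1)) ≫ rho U h :=
  (comp_eq_map U fun i => by rw [delta_apply, front_apply, front_apply]; simp; omega).symm

theorem tau_succ {k p : ℕ} (h : p ≤ k) :
    tau U (Nat.le_succ_of_le h) = U.δ 0 ≫ tau U h :=
  (comp_eq_map U fun i => by rw [delta_apply, back_apply, back_apply]; simp; omega).symm

theorem delta_rho_zero {k : ℕ} (j : Fin (k + 2)) (hj : 0 < (j : ℕ)) :
    U.δ j ≫ rho U (Nat.zero_le k) = rho U (Nat.zero_le (k + 1)) :=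
  comp_eq_map U fun i => by
    rw [delta_apply, front_apply, front_apply]
    split_ifs <;> omega

theorem delta_tau_zero {k : ℕ} (j : Fin (k + 2)) (hj : (j : ℕ) < k + 1) :
    U.δ j ≫ tau U (Nat.zero_le k) = tau U (Nat.zero_le (k + 1)) :=
  comp_eq_map U fun i => by
    rw [delta_apply, back_apply, back_apply]
    split_ifs <;> omega

variable {U} {V : SimplicialObject C} (f : U ⟶ V)

theorem rho_app {k p : ℕ} (h : p ≤ k) :
    rho U h ≫ f.app (op ⦋p⦌) = f.app (op ⦋k⦌) ≫ rho V h := f.naturality _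

theorem tau_app {k p : ℕ} (h : p ≤ k) :
    tau U h ≫ f.app (op ⦋p⦌) = f.app (op ⦋k⦌) ≫ tau V h := f.naturality _

end

end TwistedComplex

namespace TwistedComplex

/-- Bidegrees `(k, q)`, `k ≥ 0`, of total degree `m`. -/
structure Bideg (m : ℤ) where
  k : ℕ
  q : ℤ
  eq : (k : ℤ) + q = m

variable {U : SimplicialObject RingedSp.{u}}

/-- `C^m(U, Hom(E, F))`: families `u^{k,q}` in `Hom^q(τ_{k,0}^* E, ρ_{k,0}^* F)`, one for each
bidegree `(k, q)` of total degree `m`. -/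
def Cochain (E F : GMod (U _⦋0⦌)) (m : ℤ) : Type u :=
  ∀ x : Bideg m, GHom (gpull (tau U (Nat.zero_le x.k)) E) (gpull (rho U (Nat.zero_le x.k)) F) x.q

section
variable {X Y A B : RingedSp.{u}}

/-- The identity `a^* E → b^* E` for `a = b`. -/
def gId {a b : X ⟶ A} (h : a = b) (E : GMod A) {q : ℤ} (hq : q = 0) :
    GHom (gpull a E) (gpull b E) q :=
  fun x => eqToHom (by rw [h, show x.tgt = x.src by have := x.eq; omega])

theorem gId_rfl (a : X ⟶ A) (E : GMod A) : gId (rfl : a = a) E rfl = GHom.id (gpull a E) := rfl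

theorem gId_comp {q s t : ℤ} {a : X ⟶ A} {b b' : X ⟶ B} {E : GMod A} {F : GMod B} {hb : b = b'}
    {hq : q = 0} (h : q + s = t) (hs : s = t) {α : X ⟶ Y} {a₀ : Y ⟶ A} {b₀ : Y ⟶ B}
    {h₁ : α ≫ a₀ = a} {h₂ : α ≫ b₀ = b} (u : GHom (gpull a₀ E) (gpull b₀ F) s) :
    (gId hb F hq).comp (gres α h₁ h₂ u) h =
      gres α h₁ (h₂.trans hb) (hs ▸ u) := by
  subst hb hq hs
  exact GHom.id_comp _ _

theorem comp_gId {q s t : ℤ} {a a' : X ⟶ A} {b : X ⟶ B} {E : GMod A} {F : GMod B} {ha : a' = a}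
    {hq : q = 0} (h : s + q = t) (hs : s = t) {α : X ⟶ Y} {a₀ : Y ⟶ A} {b₀ : Y ⟶ B}
    {h₁ : α ≫ a₀ = a} {h₂ : α ≫ b₀ = b} (u : GHom (gpull a₀ E) (gpull b₀ F) s) :
    (gres α h₁ h₂ u).comp (gId ha E hq) h =
      gres α (h₁.trans ha.symm) h₂ (hs ▸ u) := by
  subst ha hq hs
  exact GHom.comp_id _ _

theorem gres_gId {a b : Y ⟶ A} {a' b' : X ⟶ A} {h : a = b} {E : GMod A} {q : ℤ} {hq : q = 0}
    {α : X ⟶ Y} (h₁ : α ≫ a = a') (h₂ : α ≫ b = b') :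
    gres α h₁ h₂ (gId h E hq) = gId (h₁.symm.trans ((h ▸ rfl : α ≫ a = α ≫ b).trans h₂)) E hq := by
  subst h hq h₁ h₂
  exact gres_one rfl

theorem gsq_gId {A' : RingedSp.{u}} {a b : Y ⟶ A} {a' b' : X ⟶ A'} {h : a = b} {E : GMod A} {q : ℤ}
    {hq : q = 0} {α : X ⟶ Y} {f : A' ⟶ A} (h₁ : α ≫ a = a' ≫ f) (h₂ : α ≫ b = b' ≫ f)
    (h' : a' = b') :
    gsq α h₁ h₂ (gId h E hq) = gId h' (gpull f E) hq := by
  subst h hq h'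
  exact gsq_one _
end

namespace Cochain
variable {E F G K : GMod (U _⦋0⦌)}

instance (m : ℤ) : AddCommGroup (Cochain E F m) :=
  inferInstanceAs (AddCommGroup (∀ x : Bideg m,
    GHom (gpull (tau U (Nat.zero_le x.k)) E) (gpull (rho U (Nat.zero_le x.k)) F) x.q))

protected theorem ext {m : ℤ} {u v : Cochain E F m}
    (h : ∀ k q hq, u ⟨k, q, hq⟩ = v ⟨k, q, hq⟩) : u = v := by
  funext ⟨k, q, hq⟩; exact h k q hq

theorem add_apply {m : ℤ} (u v : Cochain E F m) (x : Bideg m) : (u + v) x = u x + v x := rfl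
theorem sub_apply {m : ℤ} (u v : Cochain E F m) (x : Bideg m) : (u - v) x = u x - v x := rfl
theorem zero_apply {m : ℤ} (x : Bideg m) : (0 : Cochain E F m) x = 0 := rfl
theorem smul_apply {m : ℤ} (c : ℤ) (u : Cochain E F m) (x : Bideg m) : (c • u) x = c • u x := rfl

/-- `ρ_{n,p}^*` on components of simplicial degree `p`, where `n = p + r`. -/
def rhoPull {n p r : ℕ} (h : p + r = n) {q : ℤ} :
    GHom (gpull (tau U (Nat.zero_le p)) E) (gpull (rho U (Nat.zero_le p)) F) q →+
      GHom (gpull (rho U (Nat.le.intro h) ≫ tau U (Nat.zero_le p)) E)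
        (gpull (rho U (Nat.zero_le n)) F) q :=
  gres (rho U (Nat.le.intro h)) rfl (rho_rho U _ _)

/-- `τ_{n,r}^*` on components of simplicial degree `r`, where `n = p + r`. -/
def tauPull {n p r : ℕ} (h : p + r = n) {q : ℤ} :
    GHom (gpull (tau U (Nat.zero_le r)) E) (gpull (rho U (Nat.zero_le r)) F) q →+
      GHom (gpull (tau U (Nat.zero_le n)) E)
        (gpull (rho U (Nat.le.intro h) ≫ tau U (Nat.zero_le p)) F) q :=
  gres (tau U (Nat.le.intro ((add_comm r p).trans h))) (tau_tau U _ _)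
    (tau_rho U _ _ _ _ (by omega))

/-- The summand `(-1)^{qr} (ρ_{n,p}^* u^{p,q}) ∘ (τ_{n,r}^* v^{r,s})` of the composition, where
`q = m - p`, `s = m' - r`. -/
def term {m m' : ℤ} (u : Cochain F G m) (v : Cochain E F m') (n p r : ℕ) (h : p + r = n) (t : ℤ)
    (ht : (n : ℤ) + t = m + m') :
    GHom (gpull (tau U (Nat.zero_le n)) E) (gpull (rho U (Nat.zero_le n)) G) t :=
  sgn ((m - p) * r) • (rhoPull h (u ⟨p, m - p, by omega⟩)).comp (tauPull h (v ⟨r, m' - r, by omega⟩))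
    (by change (m - (p : ℤ)) + (m' - (r : ℤ)) = t; omega)

/-- The composition `u · v` of cochains: its component of simplicial degree `n` is the sum of the
`(-1)^{qr} (ρ_{n,p}^* u^{p,q}) ∘ (τ_{n,r}^* v^{r,s})` over `p + r = n`. -/
def comp {m m' l : ℤ} (u : Cochain F G m) (v : Cochain E F m') (h : m + m' = l) : Cochain E G l :=
  fun x => ∑ p : Fin (x.k + 1), term u v x.k p (x.k - p) (by omega) x.q (by rw [h, x.eq])

/-- `(δ u)^{k+1,q} = ∑_{j=1}^{k} (-1)^j ∂_j^* u^{k,q}`; the outer faces `∂_0`, `∂_{k+1}` are left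
out. -/
def deltaFun {m l : ℤ} (h : m + 1 = l) (u : Cochain E F m) : Cochain E F l := fun x => match x with
  | ⟨0, _, _⟩ => 0
  | ⟨k + 1, q, hq⟩ => ∑ j : Fin k, sgn ((j : ℤ) + 1) •
      gres (U.δ j.succ.castSucc) (delta_tau_zero U _ (by simp)) (delta_rho_zero U _ (by simp))
        (u ⟨k, q, by push_cast at hq; omega⟩)

/-- The Čech-style differential `δ` as an additive map. -/
def delta {m l : ℤ} (h : m + 1 = l) : Cochain E F m →+ Cochain E F l :=
  AddMonoidHom.mk' (deltaFun h) fun u v => by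
    refine Cochain.ext fun k q hq => ?_
    cases k with
    | zero => exact (add_zero _).symm
    | succ k => simp [deltaFun, add_apply, Finset.sum_add_distrib]

theorem delta_zero {m l : ℤ} (h : m + 1 = l) (u : Cochain E F m) (q hq) :
    delta h u ⟨0, q, hq⟩ = 0 := rfl

theorem delta_succ {m l : ℤ} (h : m + 1 = l) (u : Cochain E F m) (k : ℕ) (q hq) :
    delta h u ⟨k + 1, q, hq⟩ = ∑ j : Fin k, sgn ((j : ℤ) + 1) •
      gres (U.δ j.succ.castSucc) (delta_tau_zero U _ (by simp)) (delta_rho_zero U _ (by simp))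
        (u ⟨k, q, by push_cast at hq; omega⟩) := rfl

/-- The identity cochain, concentrated in bidegree `(0, 0)`. -/
protected def id (E : GMod (U _⦋0⦌)) : Cochain E E 0 := fun x => match x with
  | ⟨0, _, hq⟩ => gId ((tau_self U _).trans (rho_self U _).symm) E (by simpa using hq)
  | ⟨_ + 1, _, _⟩ => 0

theorem term_add_left {m m' : ℤ} (u u' : Cochain F G m) (v : Cochain E F m') (n p r : ℕ)
    (h : p + r = n) (t : ℤ) (ht : (n : ℤ) + t = m + m') :
    term (u + u') v n p r h t ht = term u v n p r h t ht + term u' v n p r h t ht := by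
  simp [term, add_apply, GHom.add_comp]

theorem term_add_right {m m' : ℤ} (u : Cochain F G m) (v v' : Cochain E F m') (n p r : ℕ)
    (h : p + r = n) (t : ℤ) (ht : (n : ℤ) + t = m + m') :
    term u (v + v') n p r h t ht = term u v n p r h t ht + term u v' n p r h t ht := by
  simp [term, add_apply, GHom.comp_add]

theorem add_comp {m m' l : ℤ} (u u' : Cochain F G m) (v : Cochain E F m') (h : m + m' = l) :
    (u + u').comp v h = u.comp v h + u'.comp v h := by
  funext x; simp [comp, add_apply, term_add_left, Finset.sum_add_distrib]

theorem comp_add {m m' l : ℤ} (u : Cochain F G m) (v v' : Cochain E F m') (h : m + m' = l) :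
    u.comp (v + v') h = u.comp v h + u.comp v' h := by
  funext x; simp [comp, add_apply, term_add_right, Finset.sum_add_distrib]

/-- Composition of cochains as a biadditive map. -/
def compHom {m m' l : ℤ} (h : m + m' = l) : Cochain F G m →+ Cochain E F m' →+ Cochain E G l :=
  AddMonoidHom.mk' (fun u => AddMonoidHom.mk' (fun v => u.comp v h) fun v v' => comp_add u v v' h)
    fun u u' => by ext v : 1; exact add_comp u u' v h

@[simp] theorem compHom_apply {m m' l : ℤ} (h : m + m' = l) (u : Cochain F G m)
    (v : Cochain E F m') : compHom h u v = u.comp v h := rfl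

theorem term_eq {m m' : ℤ} (u : Cochain F G m) (v : Cochain E F m') {n p r : ℕ}
    (h : p + r = n) {t : ℤ} (ht : (n : ℤ) + t = m + m') {q s : ℤ} (hq : (p : ℤ) + q = m)
    (hs : (r : ℤ) + s = m') :
    term u v n p r h t ht = sgn (q * r) • (rhoPull h (u ⟨p, q, hq⟩)).comp
      (tauPull h (v ⟨r, s, hs⟩)) (by change q + s = t; omega) := by
  obtain rfl : q = m - p := by omega
  obtain rfl : s = m' - r := by omega
  rfl

theorem term_congr {m m' : ℤ} (u : Cochain F G m) (v : Cochain E F m') {n p r p' r' : ℕ}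
    (hp : p = p') (hr : r = r')
    (h : p + r = n) (h' : p' + r' = n) {t : ℤ} (ht : (n : ℤ) + t = m + m')  :
    term u v n p r h t ht = term u v n p' r' h' t ht := by
  subst hp hr; rfl

theorem id_comp {m : ℤ} (v : Cochain E F m) (h : 0 + m = m) : (Cochain.id F).comp v h = v := by
  refine Cochain.ext fun k t ht => ?_
  change ∑ p : Fin (k + 1), _ = _
  rw [Finset.sum_eq_single 0]
  · have := term_eq (Cochain.id F) v (n := k) (p := 0) (r := k) (by simp) (t := t) (by omega)
      (q := 0) (s := t) (by simp) ht
    refine this.trans ?_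
    rw [zero_mul, sgn_zero, one_smul]
    have e := gres_gId (E := F) (h := (tau_self U le_rfl).trans (rho_self U le_rfl).symm)
      (hq := rfl) (α := rho U (Nat.zero_le k)) rfl (rho_rho U (Nat.zero_le k) (Nat.zero_le 0))
    refine (congrArg (fun w => GHom.comp w _ _) e).trans ?_
    exact (gId_comp (zero_add t) rfl _).trans (gres_id (tau_self U _) _ _ _)
  · intro p _ hp
    obtain ⟨p, hp'⟩ := p
    cases p with
    | zero => exact absurd rfl hp
    | succ p =>
      change sgn _ • ((rhoPull _ 0).comp _ _) = 0
      have : ∀ {q s t : ℤ} {X : RingedSp.{u}} {A B C : GMod X} (h : q + s = t) (w : GHom A B s),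
        (0 : GHom B C q).comp w h = 0 := fun h w => by
          simpa using GHom.add_comp (0 : GHom _ _ _) 0 w h
      rw [map_zero, this, smul_zero]
  · simp

theorem comp_id {m : ℤ} (v : Cochain E F m) (h : m + 0 = m) : v.comp (Cochain.id E) h = v := by
  refine Cochain.ext fun k t ht => ?_
  change ∑ p : Fin (k + 1), _ = _
  rw [Finset.sum_eq_single (Fin.last k)]
  · have := term_eq v (Cochain.id E) (n := k) (p := k) (r := 0) (by simp) (t := t) (by omega)
      (q := t) (s := 0) ht (by simp)
    refine (term_congr v (Cochain.id E) rfl (Nat.sub_self k) _ (add_zero k) _).trans (this.trans ?_)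
    rw [show t * ((0 : ℕ) : ℤ) = 0 by simp, sgn_zero, one_smul]
    have e := gres_gId (E := E) (h := (tau_self U le_rfl).trans (rho_self U le_rfl).symm)
      (hq := rfl) (α := tau U (Nat.zero_le k)) (tau_tau U (Nat.zero_le k) (Nat.zero_le 0))
      (tau_rho U (Nat.zero_le k) (Nat.zero_le 0) le_rfl (Nat.zero_le k) (by omega))
    refine (congrArg (fun w => GHom.comp _ w _) e).trans ?_
    exact (comp_gId (add_zero t) rfl _).trans (gres_id (rho_self U _) _ _ _)
  · intro p _ hp
    have : (p : ℕ) < k := lt_of_le_of_ne (Nat.lt_succ_iff.1 p.2) fun h => hp (Fin.ext h)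
    refine (term_congr v (Cochain.id E) rfl (by omega : k - p = (k - p - 1) + 1) _
      (by change (p : ℕ) + _ = k; omega) _).trans ?_
    change sgn _ • ((rhoPull _ _).comp (tauPull _ 0) _) = 0
    have : ∀ {q s t : ℤ} {X : RingedSp.{u}} {A B C : GMod X} (h : q + s = t) (w : GHom B C q),
      w.comp (0 : GHom A B s) h = 0 := fun h w => by
        simpa using GHom.comp_add w (0 : GHom _ _ _) 0 h
    rw [map_zero, this, smul_zero]
  · simp
end Cochain

end TwistedComplex

namespace TwistedComplex
namespace Cochain
variable {U : SimplicialObject RingedSp.{u}} {E F G K : GMod (U _⦋0⦌)}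

theorem pull_assoc {n p q r a b : ℕ} (h₁ : p + q = a) (h : a + r = n) (h₂ : p + b = n)
    (h₃ : q + r = b) {i j k ij jk t : ℤ} (e₁ : i + j = ij) (e₂ : ij + k = t) (e₃ : j + k = jk)
    (e₄ : i + jk = t)
    (x : GHom (gpull (tau U (Nat.zero_le p)) G) (gpull (rho U (Nat.zero_le p)) K) i)
    (y : GHom (gpull (tau U (Nat.zero_le q)) F) (gpull (rho U (Nat.zero_le q)) G) j)
    (z : GHom (gpull (tau U (Nat.zero_le r)) E) (gpull (rho U (Nat.zero_le r)) F) k) :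
    (rhoPull h ((rhoPull h₁ x).comp (tauPull h₁ y) e₁)).comp (tauPull h z) e₂ =
      (rhoPull h₂ x).comp (tauPull h₂ ((rhoPull h₃ y).comp (tauPull h₃ z) e₃)) e₄ := by
  have hn : p ≤ n := by omega
  have f1 : rho U (Nat.le.intro h) ≫ rho U (Nat.le.intro h₁) = rho U (Nat.le.intro h₂) :=
    rho_rho U _ _
  have hb : rho U (Nat.le.intro h) ≫ rho U (Nat.le.intro h₁) ≫ tau U (Nat.zero_le p) =
      rho U (Nat.le.intro h₂) ≫ tau U (Nat.zero_le p) := by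
    rw [← Category.assoc, f1]
  have f2 : rho U (Nat.le.intro h) ≫ tau U (Nat.le.intro ((add_comm q p).trans h₁)) =
      tau U (Nat.le.intro ((add_comm b p).trans h₂)) ≫ rho U (Nat.le.intro h₃) :=
    (tau_rho U _ _ _ _ (by omega)).symm
  have hc : tau U (Nat.le.intro ((add_comm b p).trans h₂)) ≫ rho U (Nat.le.intro h₃) ≫
      tau U (Nat.zero_le q) = rho U (Nat.le.intro h) ≫ tau U (Nat.zero_le a) := by
    rw [← Category.assoc, ← f2, Category.assoc, tau_tau]
  have f3 : tau U (Nat.le.intro ((add_comm b p).trans h₂)) ≫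
      tau U (Nat.le.intro ((add_comm r q).trans h₃)) = tau U (Nat.le.intro ((add_comm r a).trans h)) :=
    tau_tau U _ _
  unfold rhoPull tauPull
  rw [gres_comp rfl hb _ _ _ e₁, gres_comp _ hc _ _ _ e₃]
  rw [gres_gres f1 _ _ _ _ rfl (rho_rho U _ _), gres_gres f2]
  · rw [gres_gres rfl, gres_gres f3]
    · exact GHom.comp_assoc _ _ _ _ _ _ _
    · rw [Category.assoc, hc]
    · rw [← f2, Category.assoc, tau_rho U (Nat.le.intro ((add_comm q p).trans h₁)) (Nat.zero_le q)
        (Nat.le.intro h₁) (Nat.zero_le p) (by omega), hb]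

theorem pull_congr {n p q r b b' : ℕ} (h₂ : p + b = n) (h₂' : p + b' = n)
    (h₃ : q + r = b) (h₃' : q + r = b') {i j k jk jk' t : ℤ} (e₃ : j + k = jk) (e₄ : i + jk = t)
    (e₃' : j + k = jk') (e₄' : i + jk' = t)
    (x : GHom (gpull (tau U (Nat.zero_le p)) G) (gpull (rho U (Nat.zero_le p)) K) i)
    (y : GHom (gpull (tau U (Nat.zero_le q)) F) (gpull (rho U (Nat.zero_le q)) G) j)
    (z : GHom (gpull (tau U (Nat.zero_le r)) E) (gpull (rho U (Nat.zero_le r)) F) k) :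
    (rhoPull h₂ x).comp (tauPull h₂ ((rhoPull h₃ y).comp (tauPull h₃ z) e₃)) e₄ =
      (rhoPull h₂' x).comp (tauPull h₂' ((rhoPull h₃' y).comp (tauPull h₃' z) e₃')) e₄' := by
  subst h₃; obtain rfl := h₃'; subst e₃; obtain rfl := e₃'; rfl

theorem sum_reindex {M : Type*} [AddCommMonoid M] (n : ℕ) (S : ℕ → ℕ → ℕ → M) :
    ∑ a : Fin (n + 1), ∑ p : Fin (a + 1), S p (a - p) (n - a) =
      ∑ p : Fin (n + 1), ∑ q : Fin (n - p + 1), S p q (n - p - q) := by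
  rw [← Finset.sum_range fun a => ∑ p : Fin (a + 1), S p (a - p) (n - a),
    ← Finset.sum_range fun p => ∑ q : Fin (n - p + 1), S p q (n - p - q)]
  have h₁ : ∀ a, ∑ p : Fin (a + 1), S p (a - p) (n - a) =
      ∑ p ∈ Finset.range (a + 1), S p (a - p) (n - a) :=
    fun a => (Finset.sum_range fun p => S p (a - p) (n - a)).symm
  have h₂ : ∀ p, ∑ q : Fin (n - p + 1), S p q (n - p - q) =
      ∑ q ∈ Finset.range (n - p + 1), S p q (n - p - q) :=
    fun p => (Finset.sum_range fun q => S p q (n - p - q)).symm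
  simp only [h₁, h₂]
  rw [Finset.sum_sigma', Finset.sum_sigma']
  refine Finset.sum_bij' (fun x _ => ⟨x.2, x.1 - x.2⟩) (fun x _ => ⟨x.1 + x.2, x.1⟩) ?_ ?_ ?_ ?_ ?_
  · rintro ⟨a, p⟩ h; simp at h ⊢; omega
  · rintro ⟨a, p⟩ h; simp at h ⊢; omega
  · rintro ⟨a, p⟩ h; simp at h ⊢; omega
  · rintro ⟨a, p⟩ h; simp at h ⊢
  · rintro ⟨a, p⟩ h; simp at h ⊢; congr 1; omega

theorem GHom_sum_comp {X : RingedSp.{u}} {A B C : GMod X} {q s t : ℤ} (h : q + s = t) {ι : Type*}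
    (S : Finset ι) (c : ι → ℤ) (f : ι → GHom B C q) (v : GHom A B s) :
    (∑ i ∈ S, c i • f i).comp v h = ∑ i ∈ S, c i • (f i).comp v h := by
  change GHom.compHom h (∑ i ∈ S, c i • f i) v = _
  simp [map_sum]
  rfl

theorem GHom_comp_sum {X : RingedSp.{u}} {A B C : GMod X} {q s t : ℤ} (h : q + s = t) {ι : Type*}
    (S : Finset ι) (c : ι → ℤ) (v : GHom B C q) (f : ι → GHom A B s) :
    v.comp (∑ i ∈ S, c i • f i) h = ∑ i ∈ S, c i • v.comp (f i) h := by
  change GHom.compHom h v (∑ i ∈ S, c i • f i) = _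
  simp [map_sum]
  rfl

theorem comp_assoc {m₁ m₂ m₃ m₁₂ m₂₃ l : ℤ} (u : Cochain G K m₁) (v : Cochain F G m₂)
    (w : Cochain E F m₃) (h₁ : m₁ + m₂ = m₁₂) (h₂ : m₁₂ + m₃ = l) (h₃ : m₂ + m₃ = m₂₃)
    (h₄ : m₁ + m₂₃ = l) : (u.comp v h₁).comp w h₂ = u.comp (v.comp w h₃) h₄ := by
  subst h₁ h₃
  refine Cochain.ext fun n t hn => ?_
  let S : ℕ → ℕ → ℕ → GHom (gpull (tau U (Nat.zero_le n)) E) (gpull (rho U (Nat.zero_le n)) K) t :=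
    fun p q r => if h : p + q + r = n then
      sgn ((m₁ - p) * q + (m₁ + m₂ - p - q) * r) •
        (rhoPull (by omega : p + (q + r) = n) (u ⟨p, m₁ - p, by omega⟩)).comp (tauPull (by omega)
          ((rhoPull (n := q + r) (r := r) rfl (v ⟨q, m₂ - q, by omega⟩)).comp
            (tauPull (n := q + r) (p := q) rfl (w ⟨r, m₃ - r, by omega⟩))
          (rfl : m₂ - q + (m₃ - r) = _)))
          (by change m₁ - p + (m₂ - q + (m₃ - r)) = t; omega)
      else 0
  have L : ∀ a : Fin (n + 1), term (u.comp v rfl) w n a (n - a) (by omega) t (by omega) =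
      ∑ p : Fin (a + 1), S p (a - p) (n - a) := by
    intro a
    change sgn _ • (GHom.comp (rhoPull _ (∑ p : Fin (a + 1), _)) _ _) = _
    simp only [term, map_sum, map_zsmul]
    rw [GHom_sum_comp, Finset.smul_sum]
    refine Finset.sum_congr rfl fun p _ => ?_
    dsimp only [S]
    rw [dif_pos (by omega), smul_smul, ← sgn_add]
    refine congr_arg₂ (· • ·) ?_ ?_
    · congr 1
      have : ((a - p : ℕ) : ℤ) = a - p := by omega
      rw [this]; ring
    · exact pull_assoc _ _ _ _ _ _ _ _ _ _ _
  have R : ∀ p : Fin (n + 1), term u (v.comp w rfl) n p (n - p) (by omega) t (by omega) =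
      ∑ q : Fin (n - p + 1), S p q (n - p - q) := by
    intro p
    change sgn _ • (GHom.comp _ (tauPull _ (∑ q : Fin (n - p + 1), _)) _) = _
    simp only [term, map_sum, map_zsmul]
    rw [GHom_comp_sum, Finset.smul_sum]
    refine Finset.sum_congr rfl fun q _ => ?_
    dsimp only [S]
    rw [dif_pos (by omega), smul_smul, ← sgn_add]
    refine congr_arg₂ (· • ·) ?_ ?_
    · congr 1
      have : ((n - p - q : ℕ) : ℤ) = ((n - p : ℕ) : ℤ) - q := by omega
      rw [this]; ring
    · exact pull_congr _ _ _ _ _ _ _ _ _ _ _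
  change ∑ p : Fin (n + 1), _ = ∑ p : Fin (n + 1), _
  simp only [L, R]
  exact sum_reindex n S

end Cochain

end TwistedComplex

namespace TwistedComplex
namespace Cochain
variable {U : SimplicialObject RingedSp.{u}} {E F G K : GMod (U _⦋0⦌)}

/-- The pullback along an inner face. -/
def face {k : ℕ} (j : Fin k) {q : ℤ} :
    GHom (gpull (tau U (Nat.zero_le k)) E) (gpull (rho U (Nat.zero_le k)) F) q →+
      GHom (gpull (tau U (Nat.zero_le (k + 1))) E) (gpull (rho U (Nat.zero_le (k + 1))) F) q :=
  gres (U.δ j.succ.castSucc) (delta_tau_zero U _ (by simp)) (delta_rho_zero U _ (by simp))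

theorem gres_face {n : ℕ} (j : Fin (n + 1)) (i : Fin n) (j' : Fin n) (i' : Fin (n + 1))
    (hi : (i : ℕ) = i') (hj : (j : ℕ) = j' + 1) (hij : (i : ℕ) < j) {q : ℤ}
    (w : GHom (gpull (tau U (Nat.zero_le n)) E) (gpull (rho U (Nat.zero_le n)) F) q) :
    face j (face i w) = face i' (face j' w) := by
  have e : U.δ j.succ.castSucc ≫ U.δ i.succ.castSucc = U.δ i'.succ.castSucc ≫ U.δ j'.succ.castSucc :=
    comp_eq_comp U fun x => by
      simp only [delta_apply, Fin.val_castSucc, Fin.val_succ]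
      split_ifs <;> omega
  unfold face
  rw [gres_gres e _ _ _ _ (by
    rw [Category.assoc, delta_tau_zero _ _ (by simp), delta_tau_zero _ _ (by simp; omega)])
    (by rw [Category.assoc, delta_rho_zero _ _ (by simp), delta_rho_zero _ _ (by simp)]),
    gres_gres rfl]

theorem sum_cancel {M : Type*} [AddCommGroup M] (n : ℕ) (S : Fin (n + 1) → Fin n → M)
    (h : ∀ (j : Fin (n + 1)) (i j' : Fin n) (i' : Fin (n + 1)), (i : ℕ) = i' → (j : ℕ) = j' + 1 →
      (i : ℕ) < j → S j i + S i' j' = 0) : ∑ j, ∑ i, S j i = 0 := by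
  rw [← Fintype.sum_prod_type']
  refine Finset.sum_involution
    (fun x _ => if hx : (x.2 : ℕ) < x.1 then (⟨x.2, by omega⟩, ⟨x.1 - 1, by omega⟩)
      else (⟨x.2 + 1, by omega⟩, ⟨x.1, by omega⟩)) ?_ ?_ (fun _ _ => Finset.mem_univ _) ?_
  · rintro ⟨j, i⟩ -
    dsimp only
    split_ifs with hx
    · exact h _ _ _ _ rfl (by simp; omega) hx
    · rw [add_comm]; exact h _ _ _ _ rfl rfl (by simp; omega)
  · rintro ⟨j, i⟩ - -
    dsimp only
    split_ifs with hx
    · intro e; have := congrArg (fun y => (y.1 : ℕ)) e; simp at this; omega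
    · intro e; have := congrArg (fun y => (y.1 : ℕ)) e; simp at this; omega
  · rintro ⟨j, i⟩ -
    by_cases hx : (i : ℕ) < j
    · have : ¬ ((j : ℕ) - 1 < i) := by omega
      simp only [hx, dif_pos, this, dif_neg, not_false_iff]
      ext <;> (simp <;> omega)
    · have : (j : ℕ) < i + 1 := by omega
      simp only [hx, dif_pos, this, dif_neg, not_false_iff]
      ext <;> simp

theorem delta_delta {m l k : ℤ} (h : m + 1 = l) (h' : l + 1 = k) (u : Cochain E F m) :
    delta h' (delta h u) = 0 := by
  refine Cochain.ext fun n q hq => ?_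
  match n with
  | 0 => rfl
  | 1 => rfl
  | n + 2 =>
    have hq' : (n : ℤ) + q = m := by push_cast at hq; omega
    change _ = 0
    have e : delta h' (delta h u) ⟨n + 2, q, hq⟩ = ∑ j : Fin (n + 1), ∑ i : Fin n,
        sgn (j + 1 + (i + 1)) • face j (face i (u ⟨n, q, hq'⟩)) := by
      refine (delta_succ h' _ _ _ _).trans (Finset.sum_congr rfl fun j _ => ?_)
      rw [delta_succ, map_sum, Finset.smul_sum]
      refine Finset.sum_congr rfl fun i _ => ?_
      rw [map_zsmul, smul_smul, ← sgn_add]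
      rfl
    refine e.trans (sum_cancel n _ fun j i j' i' hi hj hij => ?_)
    rw [gres_face j i j' i' hi hj hij, ← add_smul]
    have : sgn (j + 1 + (i + 1)) + sgn (i' + 1 + (j' + 1)) = 0 := by
      rw [show ((j : ℕ) : ℤ) + 1 + ((i : ℕ) + 1) = (i' : ℕ) + 1 + ((j' : ℕ) + 1) + 1 by omega,
        sgn_add _ 1, sgn_one]; ring
    rw [this, zero_smul]
end Cochain

end TwistedComplex

namespace TwistedComplex
namespace Cochain
variable {U : SimplicialObject RingedSp.{u}} {E F G K : GMod (U _⦋0⦌)}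

theorem delta_rho_of_lt {p k : ℕ} (h : p ≤ k) (h' : p+1 ≤ k+1) (i : Fin k) (j : Fin p) (hi : (i : ℕ) = j) : U.δ i.succ.castSucc ≫ rho U h =
      rho U h' ≫ U.δ j.succ.castSucc :=
    comp_eq_comp U fun x => by
      rw [delta_apply, front_apply, front_apply, delta_apply]
      simp only [Fin.val_castSucc, Fin.val_succ, hi]
theorem delta_tau_of_lt {r k : ℕ} (h : r ≤ k) (h' : r ≤ k+1) (i : Fin k) (hi : (i : ℕ) < k - r) : U.δ i.succ.castSucc ≫ tau U h = tau U h' :=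
    comp_eq_map U fun x => by
      rw [delta_apply, back_apply, back_apply]
      simp only [Fin.val_castSucc, Fin.val_succ]
      rw [if_neg (by omega)]; omega
theorem delta_rho_of_le {p k : ℕ} (h : p ≤ k) (h' : p ≤ k+1) (i : Fin k) (hi : p ≤ (i : ℕ)) : U.δ i.succ.castSucc ≫ rho U h = rho U h' :=
    comp_eq_map U fun x => by
      rw [delta_apply, front_apply, front_apply]
      simp only [Fin.val_castSucc, Fin.val_succ]
      rw [if_pos (by omega)]
theorem delta_tau_of_le {r k : ℕ} (h : r ≤ k) (h' : r + 1 ≤ k+1) (i : Fin k) (j : Fin r) (hi : (i : ℕ) = k - r + j) : U.δ i.succ.castSucc ≫ tau U h = tau U h' ≫ U.δ j.succ.castSucc :=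
    comp_eq_comp U fun x => by
      rw [delta_apply, back_apply, back_apply, delta_apply]
      simp only [Fin.val_castSucc, Fin.val_succ, hi]
      split_ifs <;> omega
theorem face_left {p r k : ℕ} (h : p + r = k) (h' : p + 1 + r = k + 1) {q s t : ℤ} (e : q + s = t)
    (x : GHom (gpull (tau U (Nat.zero_le p)) F) (gpull (rho U (Nat.zero_le p)) G) q)
    (y : GHom (gpull (tau U (Nat.zero_le r)) E) (gpull (rho U (Nat.zero_le r)) F) s)
    (j : Fin p) (i : Fin k) (hi : (i : ℕ) = j) :
    face i ((rhoPull h x).comp (tauPull h y) e) =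
      (rhoPull h' (face j x)).comp (tauPull h' y) e := by
  have f1 : U.δ i.succ.castSucc ≫ rho U (Nat.le.intro h) =
      rho U (Nat.le.intro h') ≫ U.δ j.succ.castSucc :=
    delta_rho_of_lt _ _ i j hi
  have f2 : U.δ i.succ.castSucc ≫ tau U (Nat.le.intro ((add_comm r p).trans h)) =
      tau U (Nat.le.intro ((add_comm r (p + 1)).trans h')) :=
    delta_tau_of_lt _ _ i (by omega)
  have hb : U.δ i.succ.castSucc ≫ rho U (Nat.le.intro h) ≫ tau U (Nat.zero_le p) =
      rho U (Nat.le.intro h') ≫ tau U (Nat.zero_le (p + 1)) := by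
    rw [← Category.assoc, f1, Category.assoc, delta_tau_zero _ _ (by simp)]
  unfold rhoPull tauPull face
  rw [gres_comp _ hb _ _ _ e, gres_gres f1 _ _ _ _ (by rw [Category.assoc, delta_tau_zero _ _ (by simp)])
    (by rw [Category.assoc, delta_rho_zero _ _ (by simp), rho_rho]), gres_gres f2, gres_gres rfl]

theorem face_right {p r k : ℕ} (h : p + r = k) (h' : p + (r + 1) = k + 1) {q s t : ℤ}
    (e : q + s = t)
    (x : GHom (gpull (tau U (Nat.zero_le p)) F) (gpull (rho U (Nat.zero_le p)) G) q)
    (y : GHom (gpull (tau U (Nat.zero_le r)) E) (gpull (rho U (Nat.zero_le r)) F) s)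
    (j : Fin r) (i : Fin k) (hi : (i : ℕ) = p + j) :
    face i ((rhoPull h x).comp (tauPull h y) e) =
      (rhoPull h' x).comp (tauPull h' (face j y)) e := by
  have f1 : U.δ i.succ.castSucc ≫ rho U (Nat.le.intro h) = rho U (Nat.le.intro h') :=
    delta_rho_of_le _ _ i (by omega)
  have f2 : U.δ i.succ.castSucc ≫ tau U (Nat.le.intro ((add_comm r p).trans h)) =
      tau U (Nat.le.intro ((add_comm (r + 1) p).trans h')) ≫ U.δ j.succ.castSucc :=
    delta_tau_of_le _ _ i j (by omega)
  have hb : U.δ i.succ.castSucc ≫ rho U (Nat.le.intro h) ≫ tau U (Nat.zero_le p) =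
      rho U (Nat.le.intro h') ≫ tau U (Nat.zero_le p) := by
    rw [← Category.assoc, f1]
  have hc : tau U (Nat.le.intro ((add_comm (r + 1) p).trans h')) ≫ U.δ j.succ.castSucc ≫
      rho U (Nat.zero_le r) = rho U (Nat.le.intro h') ≫ tau U (Nat.zero_le p) := by
    rw [delta_rho_zero _ _ (by simp), tau_rho]; omega
  unfold rhoPull tauPull face
  rw [gres_comp _ hb _ _ _ e, gres_gres f1, gres_gres f2 _ _ _ _
    (by rw [Category.assoc, delta_tau_zero _ _ (by simp), tau_tau])
    (by rw [Category.assoc, hc]), gres_gres rfl]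

theorem delta_comp {m m' l m1 m1' l1 : ℤ} (h : m + m' = l) (hl : l + 1 = l1) (hm : m + 1 = m1)
    (hm' : m' + 1 = m1') (h₁ : m1 + m' = l1) (h₂ : m + m1' = l1)
    (u : Cochain F G m) (v : Cochain E F m') :
    delta hl (u.comp v h) = (delta hm u).comp v h₁ + sgn m • u.comp (delta hm' v) h₂ := by
  subst h hl hm hm'
  have zl : ∀ n r (h : 0 + r = n) t ht, term (delta rfl u) v n 0 r h t ht = 0 := by
    intro n r h t ht
    change sgn _ • ((rhoPull h 0).comp _ _) = 0
    rw [map_zero]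
    have := GHom_sum_comp (by change (m + 1 - ((0 : ℕ) : ℤ)) + (m' - r) = t; omega) (∅ : Finset ℕ)
      (fun _ => 0) (fun _ => (0 : GHom _ (gpull (rho U (Nat.zero_le n)) G) _))
      (tauPull h (v ⟨r, m' - r, by omega⟩))
    rw [Finset.sum_empty, Finset.sum_empty] at this
    exact (congrArg _ this).trans (smul_zero _)
  have zr : ∀ n p (h : p + 0 = n) t ht, term u (delta rfl v) n p 0 h t ht = 0 := by
    intro n p h t ht
    change sgn _ • ((rhoPull h _).comp (tauPull h 0) _) = 0
    have := GHom_comp_sum (by change (m - (p : ℤ)) + (m' + 1 - (0 : ℕ)) = t; omega) (∅ : Finset ℕ)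
      (fun _ => 0) (rhoPull h (u ⟨p, m - p, by omega⟩))
      (fun _ => (0 : GHom (gpull (tau U (Nat.zero_le n)) E) _ _))
    rw [Finset.sum_empty, Finset.sum_empty] at this
    rw [map_zero]
    exact (congrArg _ this).trans (smul_zero _)
  refine Cochain.ext fun n t hn => ?_
  cases n with
  | zero =>
    have e1 : (delta rfl u).comp v h₁ ⟨0, t, hn⟩ = 0 :=
      (Fin.sum_univ_one _).trans (zl 0 0 rfl t _)
    have e2 : u.comp (delta rfl v) h₂ ⟨0, t, hn⟩ = 0 :=
      (Fin.sum_univ_one _).trans (zr 0 0 rfl t _)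
    rw [add_apply, smul_apply, e1, e2, smul_zero, add_zero]
    rfl
  | succ k =>
    have ht : (k : ℤ) + t = m + m' := by push_cast at hn; omega
    have main : ∀ p r, (h : p + r = k) →
        ∑ j : Fin k, sgn ((j : ℤ) + 1) • face j (term u v k p r h t ht) =
          term (delta rfl u) v (k + 1) (p + 1) r (by omega) t (by omega) +
            sgn m • term u (delta rfl v) (k + 1) p (r + 1) (by omega) t (by omega) := by
      intro p r h
      have e1 : (p : ℤ) + (m - p) = m := by omega
      have e2 : (r : ℤ) + (m' - r) = m' := by omega
      rw [term_eq u v h ht e1 e2,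
        term_eq (delta rfl u) v (by omega : p + 1 + r = k + 1) (by omega) (q := m - p)
          (by push_cast; omega) e2,
        term_eq u (delta rfl v) (by omega : p + (r + 1) = k + 1) (by omega) e1 (s := m' - r)
          (by push_cast; omega),
        delta_succ, delta_succ, map_sum, map_sum]
      simp only [map_zsmul]
      rw [GHom_sum_comp, GHom_comp_sum]
      subst h
      rw [Fin.sum_univ_add]
      refine congr_arg₂ (· + ·) ?_ ?_
      · rw [Finset.smul_sum]
        refine Finset.sum_congr rfl fun j _ => ?_
        rw [smul_comm]
        refine congr_arg₂ (· • ·) rfl (congr_arg₂ (· • ·) rfl ?_)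
        exact face_left rfl _ _ _ _ j _ rfl
      · rw [Finset.smul_sum, Finset.smul_sum]
        refine Finset.sum_congr rfl fun j _ => ?_
        rw [smul_smul, smul_smul, smul_smul]
        refine congr_arg₂ (· • ·) ?_ (face_right rfl _ _ _ _ j _ rfl)
        rw [← sgn_add, ← sgn_add, ← sgn_add]
        refine sgn_congr ⟨((p : ℕ) : ℤ) - m, ?_⟩
        simp only [Fin.val_natAdd]
        push_cast
        ring
    have L : delta rfl (u.comp v rfl) ⟨k + 1, t, hn⟩ = ∑ p : Fin (k + 1), ∑ j : Fin k,
        sgn ((j : ℤ) + 1) • face j (term u v k p (k - p) (by omega) t ht) := by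
      rw [Finset.sum_comm, delta_succ]
      refine Finset.sum_congr rfl fun j _ => ?_
      rw [← Finset.smul_sum, ← map_sum]
      rfl
    rw [L, add_apply, smul_apply]
    have R1 : (delta rfl u).comp v h₁ ⟨k + 1, t, hn⟩ = ∑ p : Fin (k + 1),
        term (delta rfl u) v (k + 1) (p + 1) (k - p) (by omega) t (by omega) := by
      refine (Fin.sum_univ_succ (n := k + 1) _).trans ?_
      refine (congrArg (· + _) (zl _ _ _ _ _)).trans ((zero_add _).trans ?_)
      refine Finset.sum_congr rfl fun p _ => ?_
      exact term_congr _ _ rfl (by simp) _ _ _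
    have R2 : u.comp (delta rfl v) h₂ ⟨k + 1, t, hn⟩ = ∑ p : Fin (k + 1),
        term u (delta rfl v) (k + 1) p (k - p + 1) (by omega) t (by omega) := by
      refine (Fin.sum_univ_castSucc (n := k + 1) _).trans ?_
      have : term u (delta rfl v) (k + 1) (Fin.last (k + 1)) (k + 1 - (Fin.last (k + 1)))
          (by simp) t (by omega) = 0 :=
        (term_congr u (delta rfl v) rfl (by simp) _ (by simp) _).trans (zr (k + 1) (k + 1) rfl _ _)
      refine (congrArg (_ + ·) this).trans ((add_zero _).trans ?_)
      refine Finset.sum_congr rfl fun p _ => ?_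
      exact term_congr _ _ rfl (by simp; omega) _ _ _
    rw [R1, R2, Finset.smul_sum, ← Finset.sum_add_distrib]
    exact Finset.sum_congr rfl fun p _ => main p (k - p) (by omega)
end Cochain

end TwistedComplex

namespace TwistedComplex

/-- A dg-category over `ℤ`, with cohomological grading.  All operations take a proof of the
relation between the degrees involved. `comp h u v` is the composite `u ∘ v`. -/
structure DGCat where
  Obj : Type (u + 1)
  Hom : Obj → Obj → ℤ → Type u
  [grp : ∀ X Y m, AddCommGroup (Hom X Y m)]
  id : ∀ X, Hom X X 0
  comp : ∀ {X Y Z m n l}, m + n = l → Hom Y Z m →+ Hom X Y n →+ Hom X Z l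
  d : ∀ {X Y m n}, m + 1 = n → Hom X Y m →+ Hom X Y n
  id_comp : ∀ {X Y m} (h : 0 + m = m) (u : Hom X Y m), comp h (id Y) u = u
  comp_id : ∀ {X Y m} (h : m + 0 = m) (u : Hom X Y m), comp h u (id X) = u
  assoc : ∀ {W X Y Z m₁ m₂ m₃ m₁₂ m₂₃ l} (h₁ : m₁ + m₂ = m₁₂) (h₂ : m₁₂ + m₃ = l)
    (h₃ : m₂ + m₃ = m₂₃) (h₄ : m₁ + m₂₃ = l) (u : Hom Y Z m₁) (v : Hom X Y m₂) (w : Hom W X m₃),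
    comp h₂ (comp h₁ u v) w = comp h₄ u (comp h₃ v w)
  d_d : ∀ {X Y m n l} (h : m + 1 = n) (h' : n + 1 = l) (u : Hom X Y m), d h' (d h u) = 0
  d_comp : ∀ {X Y Z m m' l m₁ m₁' l₁} (h : m + m' = l) (hl : l + 1 = l₁) (hm : m + 1 = m₁)
    (hm' : m' + 1 = m₁') (h₁ : m₁ + m' = l₁) (h₂ : m + m₁' = l₁) (u : Hom Y Z m) (v : Hom X Y m'),
    d hl (comp h u v) = comp h₁ (d hm u) v + sgn m • comp h₂ u (d hm' v)

attribute [instance] DGCat.grp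

/-- dg-functors. -/
structure DGFunctor (C D : DGCat.{u}) where
  obj : C.Obj → D.Obj
  map : ∀ {X Y m}, C.Hom X Y m →+ D.Hom (obj X) (obj Y) m
  map_id : ∀ X, map (C.id X) = D.id (obj X)
  map_comp : ∀ {X Y Z m n l} (h : m + n = l) (u : C.Hom Y Z m) (v : C.Hom X Y n),
    map (C.comp h u v) = D.comp h (map u) (map v)
  map_d : ∀ {X Y m n} (h : m + 1 = n) (u : C.Hom X Y m), map (C.d h u) = D.d h (map u)

variable {U V : SimplicialObject RingedSp.{u}}

namespace Cochain
variable {E F G K : GMod (U _⦋0⦌)}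

theorem smul_comp {m m' l : ℤ} (h : m + m' = l) (c : ℤ) (u : Cochain F G m) (v : Cochain E F m') :
    (c • u).comp v h = c • u.comp v h :=
  (congrArg (fun t => t v) (map_zsmul (compHom h) c u) :)

theorem comp_smul {m m' l : ℤ} (h : m + m' = l) (c : ℤ) (u : Cochain F G m) (v : Cochain E F m') :
    u.comp (c • v) h = c • u.comp v h :=
  map_zsmul (compHom h u) c v

theorem sub_comp {m m' l : ℤ} (h : m + m' = l) (u u' : Cochain F G m) (v : Cochain E F m') :
    (u - u').comp v h = u.comp v h - u'.comp v h :=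
  (congrArg (fun t => t v) (map_sub (compHom h) u u') :)

theorem comp_sub {m m' l : ℤ} (h : m + m' = l) (u : Cochain F G m) (v v' : Cochain E F m') :
    u.comp (v - v') h = u.comp v h - u.comp v' h :=
  map_sub (compHom h u) v v'

theorem zero_comp {m m' l : ℤ} (h : m + m' = l) (v : Cochain E F m') :
    (0 : Cochain F G m).comp v h = 0 :=
  by
  simpa using zero_smul ℤ (0 : Cochain F G m) ▸ smul_comp h 0 (0 : Cochain F G m) v

theorem comp_zero {m m' l : ℤ} (h : m + m' = l) (u : Cochain F G m) :
    u.comp (0 : Cochain E F m') h = 0 :=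
  map_zero (compHom h u)

theorem delta_id {n : ℤ} (h : 0 + 1 = n) : delta h (Cochain.id E) = 0 := by
  subst h
  have := delta_comp (add_zero 0) rfl rfl rfl (add_zero _) (zero_add _) (Cochain.id E) (Cochain.id E)
  rw [comp_id, id_comp, comp_id, sgn_zero, one_smul] at this
  simpa using this
end Cochain

/-- The pullback `τ_{1,0}^* w` of an endomorphism `w` on `U₀`. -/
def tauOne {E : GMod (U _⦋0⦌)} {q : ℤ} :
    GHom (gpull (tau U (Nat.zero_le 0)) E) (gpull (rho U (Nat.zero_le 0)) E) q →+
      GHom (gpull (tau U (Nat.zero_le 1)) E) (gpull (tau U (Nat.zero_le 1)) E) q :=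
  gres (tau U (Nat.zero_le 1)) (tau_tau U _ _) (by rw [rho_self, Category.comp_id])

/-- The pullback `ρ_{1,0}^* w` of an endomorphism `w` on `U₀`. -/
def rhoOne {E : GMod (U _⦋0⦌)} {q : ℤ} :
    GHom (gpull (tau U (Nat.zero_le 0)) E) (gpull (rho U (Nat.zero_le 0)) E) q →+
      GHom (gpull (rho U (Nat.zero_le 1)) E) (gpull (rho U (Nat.zero_le 1)) E) q :=
  gres (rho U (Nat.zero_le 1)) (by rw [tau_self, Category.comp_id]) (rho_rho U _ _)

/-- Twisted complexes on a simplicial ringed space: a graded sheaf of modules `E` on `U₀` with a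
cochain `a = (a^{k,1-k})` of total degree `1` such that `δ a + a · a = 0` and such that
`a^{1,0} : (τ_{1,0}^* E, τ_{1,0}^* a^{0,1}) → (ρ_{1,0}^* E, ρ_{1,0}^* a^{0,1})` is invertible up to
homotopy. (That `a^{1,0}` commutes with the differentials is part of `δ a + a · a = 0`.) -/
structure TwObj (U : SimplicialObject RingedSp.{u}) where
  E : GMod (U _⦋0⦌)
  a : Cochain E E 1
  maurerCartan : Cochain.delta one_add_one_eq_two a + a.comp a one_add_one_eq_two = 0
  nondegenerate : InvertibleUpToHomotopy (tauOne (a ⟨0, 1, by norm_num⟩))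
    (rhoOne (a ⟨0, 1, by norm_num⟩)) (a ⟨1, 0, by norm_num⟩)

/-- The differential `d θ = δ θ + b · θ - (-1)^m θ · a` of a morphism `θ : (E, a) → (F, b)` of
degree `m`. -/
def tw (A B : TwObj U) {m n : ℤ} (h : m + 1 = n) : Cochain A.E B.E m →+ Cochain A.E B.E n :=
  AddMonoidHom.mk' (fun θ => Cochain.delta h θ + B.a.comp θ ((add_comm 1 m).trans h) -
      sgn m • θ.comp A.a h) fun θ θ' => by
    rw [map_add, Cochain.comp_add, Cochain.add_comp, smul_add]; abel

theorem tw_apply (A B : TwObj U) {m n : ℤ} (h : m + 1 = n) (θ : Cochain A.E B.E m) :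
    tw A B h θ = Cochain.delta h θ + B.a.comp θ ((add_comm 1 m).trans h) - sgn m • θ.comp A.a h :=
  rfl

theorem sgn_succ (m : ℤ) : sgn (m + 1) = - sgn m := by rw [sgn_add, sgn_one]; ring

theorem tw_tw (A B : TwObj U) {m n l : ℤ} (h : m + 1 = n) (h' : n + 1 = l)
    (u : Cochain A.E B.E m) : tw A B h' (tw A B h u) = 0 := by
  have hn : sgn n = - sgn m := by rw [← h, sgn_succ]
  have eB : Cochain.delta one_add_one_eq_two B.a = - B.a.comp B.a one_add_one_eq_two :=
    eq_neg_of_add_eq_zero_left B.maurerCartan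
  have eA : Cochain.delta one_add_one_eq_two A.a = - A.a.comp A.a one_add_one_eq_two :=
    eq_neg_of_add_eq_zero_left A.maurerCartan
  have nl : (-(B.a.comp B.a one_add_one_eq_two)).comp u (by omega : 2 + m = l) =
      - (B.a.comp B.a one_add_one_eq_two).comp u (by omega) := by
    simpa using Cochain.smul_comp (by omega : 2 + m = l) (-1) (B.a.comp B.a one_add_one_eq_two) u
  have nr : u.comp (-(A.a.comp A.a one_add_one_eq_two)) (by omega : m + 2 = l) =
      - u.comp (A.a.comp A.a one_add_one_eq_two) (by omega) := by
    simpa using Cochain.comp_smul (by omega : m + 2 = l) (-1) u (A.a.comp A.a one_add_one_eq_two)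
  simp only [tw_apply, map_add, map_sub, map_zsmul, Cochain.delta_delta]
  rw [Cochain.delta_comp ((add_comm 1 m).trans h) h' one_add_one_eq_two h (by omega) (by omega),
    Cochain.delta_comp h h' h one_add_one_eq_two (by omega) (by omega), eA, eB, nl, nr,
    Cochain.comp_assoc B.a B.a u one_add_one_eq_two _ ((add_comm 1 m).trans h) (by omega),
    Cochain.comp_assoc u A.a A.a h _ one_add_one_eq_two (by omega),
    Cochain.comp_assoc B.a u A.a ((add_comm 1 m).trans h) (by omega) h (by omega), hn, sgn_one]
  have := sgn_mul_self m
  simp only [smul_add, smul_sub, smul_neg, neg_smul, smul_smul, one_smul, this]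
  abel

theorem tw_comp {A B C : TwObj U} {m m' l m₁ m₁' l₁ : ℤ} (h : m + m' = l) (hl : l + 1 = l₁)
    (hm : m + 1 = m₁) (hm' : m' + 1 = m₁') (h₁ : m₁ + m' = l₁) (h₂ : m + m₁' = l₁)
    (u : Cochain B.E C.E m) (v : Cochain A.E B.E m') :
    tw A C hl (u.comp v h) =
      (tw B C hm u).comp v h₁ + sgn m • u.comp (tw A B hm' v) h₂ := by
  have hs : sgn l = sgn m * sgn m' := by rw [← h, sgn_add]
  simp only [tw_apply, Cochain.comp_add, Cochain.comp_sub, Cochain.add_comp, Cochain.sub_comp,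
    Cochain.comp_smul, Cochain.smul_comp]
  rw [Cochain.delta_comp h hl hm hm' h₁ h₂,
    Cochain.comp_assoc C.a u v ((add_comm 1 m).trans hm) h₁ h (by omega),
    Cochain.comp_assoc u B.a v hm h₁ ((add_comm 1 m').trans hm') h₂,
    Cochain.comp_assoc u v A.a h hl hm' h₂, hs]
  simp only [smul_add, smul_sub, smul_smul]
  abel

/-- The dg-category of twisted complexes on a simplicial ringed space. -/
abbrev Tw (U : SimplicialObject RingedSp.{u}) : DGCat.{u} where
  Obj := TwObj U
  Hom A B m := Cochain A.E B.E m
  grp _ _ _ := inferInstance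
  id A := Cochain.id A.E
  comp h := Cochain.compHom h
  d {A B _ _} h := tw A B h
  id_comp h u := Cochain.id_comp u h
  comp_id h u := Cochain.comp_id u h
  assoc h₁ h₂ h₃ h₄ u v w := Cochain.comp_assoc u v w h₁ h₂ h₃ h₄
  d_d h h' u := tw_tw _ _ h h' u
  d_comp h hl hm hm' h₁ h₂ u v := tw_comp h hl hm hm' h₁ h₂ u v
end TwistedComplex

namespace TwistedComplex
variable {U V : SimplicialObject RingedSp.{u}}

theorem gsq_gres_comm {X X₀ Y Z A B A' B' : RingedSp.{u}} {E : GMod A} {F : GMod B} {q : ℤ} {θ : Y ⟶ Z}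
    {a : Y ⟶ A} {b : Y ⟶ B} {a₀ : Z ⟶ A} {b₀ : Z ⟶ B} {h₁ : θ ≫ a₀ = a} {h₂ : θ ≫ b₀ = b} {α : X ⟶ Y}
    {f : A' ⟶ A} {g : B' ⟶ B} {a' : X ⟶ A'} {b' : X ⟶ B'} {ha : α ≫ a = a' ≫ f}
    {hb : α ≫ b = b' ≫ g} {β : X ⟶ X₀} {α' : X₀ ⟶ Z} {a'' : X₀ ⟶ A'} {b'' : X₀ ⟶ B'}
    {ha₀ : α' ≫ a₀ = a'' ≫ f} {hb₀ : α' ≫ b₀ = b'' ≫ g} {hβa : β ≫ a'' = a'} {hβb : β ≫ b'' = b'}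
    (e : α ≫ θ = β ≫ α') (u : GHom (gpull a₀ E) (gpull b₀ F) q) :
    gsq α ha hb (gres θ h₁ h₂ u) = gres β hβa hβb (gsq α' ha₀ hb₀ u) := by
  have h1 : (β ≫ α') ≫ a₀ = a' ≫ f := by rw [Category.assoc, ha₀, ← Category.assoc, hβa]
  have h2 : (β ≫ α') ≫ b₀ = b' ≫ g := by rw [Category.assoc, hb₀, ← Category.assoc, hβb]
  rw [gsq_gres _ _ _ _ e h1 h2, gres_gsq _ _ _ _ rfl h1 h2]

namespace Cochain
variable {E F G : GMod (V _⦋0⦌)} (f : U ⟶ V)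

/-- The pullback `f^*` of cochains along a simplicial map, `(f^* u)^{k,q} = f_k^* u^{k,q}`. -/
def map {m : ℤ} : Cochain E F m →+
    Cochain (gpull (f.app (op ⦋0⦌)) E) (gpull (f.app (op ⦋0⦌)) F) m :=
  AddMonoidHom.mk' (fun u x => gsq (f.app (op ⦋x.k⦌)) (tau_app f _).symm (rho_app f _).symm (u x))
    fun u v => by
      funext x; exact map_add (gsq _ _ _) _ _

theorem map_apply {m : ℤ} (u : Cochain E F m) (x : Bideg m) :
    map f u x = gsq (f.app (op ⦋x.k⦌)) (tau_app f _).symm (rho_app f _).symm (u x) := rfl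

theorem map_id : map f (Cochain.id E) = Cochain.id (gpull (f.app (op ⦋0⦌)) E) := by
  refine Cochain.ext fun k q hq => ?_
  cases k with
  | zero =>
    exact gsq_gId (h := (tau_self V _).trans (rho_self V _).symm) (hq := by simpa using hq) _ _
      ((tau_self U _).trans (rho_self U _).symm)
  | succ k => exact map_zero (gsq _ _ _)

theorem map_term {m m' : ℤ} (u : Cochain F G m) (v : Cochain E F m') (n p r : ℕ) (h : p + r = n)
    (t : ℤ) (ht : (n : ℤ) + t = m + m') :
    gsq (f.app (op ⦋n⦌)) (tau_app f _).symm (rho_app f _).symm (term u v n p r h t ht) =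
      term (map f u) (map f v) n p r h t ht := by
  have hb : f.app (op ⦋n⦌) ≫ rho V (Nat.le.intro h) ≫ tau V (Nat.zero_le p) =
      (rho U (Nat.le.intro h) ≫ tau U (Nat.zero_le p)) ≫ f.app (op ⦋0⦌) := by
    rw [Category.assoc, tau_app, ← Category.assoc, ← rho_app, Category.assoc]
  unfold term
  rw [map_zsmul, gsq_comp _ hb]
  refine congrArg (fun w => sgn ((m - p) * r) • w) ?_
  exact congr_arg₂ (fun x y => GHom.comp x y _) (gsq_gres_comm (rho_app f _).symm _)
    (gsq_gres_comm (tau_app f _).symm _)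

theorem map_comp {m m' l : ℤ} (u : Cochain F G m) (v : Cochain E F m') (h : m + m' = l) :
    map f (u.comp v h) = (map f u).comp (map f v) h := by
  funext x
  refine (map_sum (gsq _ _ _) _ _).trans ?_
  exact Finset.sum_congr rfl fun p _ => map_term f u v _ _ _ _ _ _

theorem map_delta {m l : ℤ} (h : m + 1 = l) (u : Cochain E F m) :
    map f (delta h u) = delta h (map f u) := by
  refine Cochain.ext fun k q hq => ?_
  cases k with
  | zero => exact map_zero (gsq _ _ _)
  | succ k =>
    rw [map_apply, delta_succ, delta_succ, map_sum]
    refine Finset.sum_congr rfl fun j _ => ?_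
    rw [map_zsmul, map_apply]
    refine congrArg (fun w => sgn (j + 1) • w) ?_
    exact gsq_gres_comm (f.naturality _).symm _
end Cochain

/-- The pullback `f^* (E, a) = (f_0^* E, f^* a)` of a twisted complex. -/
abbrev TwObj.pullback (f : U ⟶ V) (A : TwObj V) : TwObj U where
  E := gpull (f.app (op ⦋0⦌)) A.E
  a := Cochain.map f A.a
  maurerCartan := by
    rw [← Cochain.map_delta, ← Cochain.map_comp, ← map_add, A.maurerCartan, map_zero]
  nondegenerate := by
    have := A.nondegenerate.gsq (tau_app f (Nat.zero_le 1)).symm (rho_app f (Nat.zero_le 1)).symm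
    unfold tauOne rhoOne at this ⊢
    have e1 := gsq_gres_comm (h₁ := tau_tau V (Nat.zero_le 1) (Nat.zero_le 0))
      (h₂ := by rw [rho_self, Category.comp_id])
      (ha := (tau_app f (Nat.zero_le 1)).symm) (hb := (tau_app f (Nat.zero_le 1)).symm)
      (ha₀ := (tau_app f (Nat.zero_le 0)).symm) (hb₀ := (rho_app f (Nat.zero_le 0)).symm)
      (hβa := tau_tau U (Nat.zero_le 1) (Nat.zero_le 0))
      (hβb := by rw [rho_self, Category.comp_id])
      (tau_app f (Nat.zero_le 1)).symm (A.a ⟨0, 1, by norm_num⟩)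
    have e2 := gsq_gres_comm (h₂ := rho_rho V (Nat.zero_le 1) (Nat.zero_le 0))
      (h₁ := by rw [tau_self, Category.comp_id])
      (ha := (rho_app f (Nat.zero_le 1)).symm) (hb := (rho_app f (Nat.zero_le 1)).symm)
      (ha₀ := (tau_app f (Nat.zero_le 0)).symm) (hb₀ := (rho_app f (Nat.zero_le 0)).symm)
      (hβb := rho_rho U (Nat.zero_le 1) (Nat.zero_le 0))
      (hβa := by rw [tau_self, Category.comp_id])
      (rho_app f (Nat.zero_le 1)).symm (A.a ⟨0, 1, by norm_num⟩)
    rw [e1, e2] at this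
    exact this

theorem map_tw (f : U ⟶ V) (A B : TwObj V) {m n : ℤ} (h : m + 1 = n) (u : Cochain A.E B.E m) :
    Cochain.map f (tw A B h u) = tw (A.pullback f) (B.pullback f) h (Cochain.map f u) := by
  have e : tw (A.pullback f) (B.pullback f) h (Cochain.map f u) = Cochain.delta h (Cochain.map f u) +
      (Cochain.map f B.a).comp (Cochain.map f u) ((add_comm 1 m).trans h) -
      sgn m • (Cochain.map f u).comp (Cochain.map f A.a) h := rfl
  rw [tw_apply, e, map_sub, map_add, map_zsmul, Cochain.map_delta, Cochain.map_comp,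
    Cochain.map_comp]

/-- The dg-functor `f^* : Tw V → Tw U` induced by a simplicial map `f : U ⟶ V`. -/
abbrev pullback (f : U ⟶ V) : DGFunctor (Tw V) (Tw U) where
  obj A := TwObj.pullback f A
  map := Cochain.map f
  map_id _ := Cochain.map_id f
  map_comp h u v := Cochain.map_comp f u v h
  map_d {A B _ _} h u := map_tw f A B h u
end TwistedComplex

namespace TwistedComplex

namespace DGCat
variable (C : DGCat.{u})

/-- Transport of a morphism along equalities of its source, target and degree. -/
def castHom {X X' Y Y' : C.Obj} {m m' : ℤ} (hX : X = X') (hY : Y = Y') (hm : m = m')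
    (u : C.Hom X Y m) : C.Hom X' Y' m' := hX ▸ hY ▸ hm ▸ u

/-- `l` consecutive homogeneous morphisms `X 0 → X 1 → ⋯ → X l` of degrees `m 0, …, m (l - 1)`. -/
abbrev Chain {l : ℕ} (X : Fin (l + 1) → C.Obj) (m : Fin l → ℤ) : Type u :=
  ∀ i : Fin l, C.Hom (X i.castSucc) (X i.succ) (m i)

variable {C}

/-- The degrees after applying `d` to the `i`-th morphism. -/
def dDeg {l : ℕ} (m : Fin l → ℤ) (i : Fin l) (j : Fin l) : ℤ := m j + if j = i then 1 else 0

/-- Apply `d` to the `i`-th morphism of a chain. -/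
def dChain {l : ℕ} {X : Fin (l + 1) → C.Obj} {m : Fin l → ℤ} (u : C.Chain X m) (i : Fin l) :
    C.Chain X (dDeg m i) := fun j =>
  if h : j = i then C.d (by simp [dDeg, h]) (u j) else C.castHom rfl rfl (by simp [dDeg, h]) (u j)

/-- Omit the object `X (i + 1)`. -/
def mergeObj {l : ℕ} (X : Fin (l + 2) → C.Obj) (i : Fin l) (j : Fin (l + 1)) : C.Obj :=
  if (j : ℕ) ≤ i then X j.castSucc else X j.succ

/-- The degrees after composing the `i`-th and the `(i + 1)`-st morphism. -/
def mergeDeg {l : ℕ} (m : Fin (l + 1) → ℤ) (i : Fin l) (j : Fin l) : ℤ :=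
  if j < i then m j.castSucc else if j = i then m j.succ + m j.castSucc else m j.succ

/-- Replace the `i`-th and `(i + 1)`-st morphisms of a chain by their composite. -/
def mergeChain {l : ℕ} {X : Fin (l + 2) → C.Obj} {m : Fin (l + 1) → ℤ} (u : C.Chain X m)
    (i : Fin l) : C.Chain (mergeObj X i) (mergeDeg m i) := fun j =>
  if h : j < i then
    C.castHom (by simp [mergeObj, h.le])
      (by rw [mergeObj, if_pos (by simpa using h)]; rfl) (by simp [mergeDeg, h]) (u j.castSucc)
  else if h' : j = i then
    C.castHom (by simp [mergeObj, h']) (by rw [mergeObj, if_neg (by simp [h'])])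
      (by simp [mergeDeg, h']) (C.comp rfl (u j.succ) (u j.castSucc))
  else
    C.castHom (by rw [mergeObj, if_neg (by simp; omega)]; rfl)
      (by rw [mergeObj, if_neg (by simp; omega)]) (by simp [mergeDeg, h, h']) (u j.succ)

theorem sum_dDeg {l : ℕ} (m : Fin l → ℤ) (i : Fin l) : ∑ j, dDeg m i j = ∑ j, m j + 1 := by
  simp [dDeg, Finset.sum_add_distrib]

theorem sum_mergeDeg {l : ℕ} (m : Fin (l + 1) → ℤ) (i : Fin l) :
    ∑ j, mergeDeg m i j = ∑ j, m j := by
  rw [Fin.sum_univ_succAbove m i.succ]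
  have : ∀ j, mergeDeg m i j = m (i.succ.succAbove j) + if j = i then m i.succ else 0 := by
    intro j
    unfold mergeDeg
    split_ifs with h h' h'
    · omega
    · rw [Fin.succAbove_of_castSucc_lt _ _ (by simp only [Fin.lt_def, Fin.val_castSucc, Fin.val_succ]; omega), add_zero]
    · subst h'
      rw [Fin.succAbove_of_castSucc_lt _ _ (by simp only [Fin.lt_def, Fin.val_castSucc, Fin.val_succ]; omega), add_comm]
    · rw [Fin.succAbove_of_le_castSucc _ _ (by simp only [Fin.le_def, Fin.val_castSucc, Fin.val_succ]; omega), add_zero]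
  simp only [this, Finset.sum_add_distrib]
  simp [add_comm]

end DGCat

variable {C D : DGCat.{u}}

/-- `A_∞`-prenatural transformations `Φ` of degree `n` between dg-functors: for all `X 0, …, X l`,
a multilinear map `Φ^l`, of degree `n - l`, from chains of `l` homogeneous morphisms
`X 0 → ⋯ → X l` to morphisms `F (X 0) → G (X l)`. For `l = 0` this is a morphism
`F (X 0) → G (X 0)` of degree `n`. -/
structure PreNat (F G : DGFunctor C D) (n : ℤ) where
  app (l : ℕ) (X : Fin (l + 1) → C.Obj) (m : Fin l → ℤ) {N : ℤ} (hN : ∑ i, m i + n - l = N) :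
    MultilinearMap ℤ (fun i : Fin l => C.Hom (X i.castSucc) (X i.succ) (m i))
      (D.Hom (F.obj (X 0)) (G.obj (X (Fin.last l))) N)

namespace PreNat
variable {F G : DGFunctor C D} {n : ℤ}

/-- `d (Φ^l (u_l ⊗ ⋯ ⊗ u_1))`. -/
def dOuter (Φ : PreNat F G n) {l : ℕ} {X : Fin (l + 1) → C.Obj} {m : Fin l → ℤ} {N : ℤ}
    (hN : ∑ i, m i + (n + 1) - l = N) (u : C.Chain X m) :
    D.Hom (F.obj (X 0)) (G.obj (X (Fin.last l))) N :=
  D.d (m := N - 1) (by omega) (Φ.app l X m (by omega) u)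

/-- `G (u_{l+1}) Φ^l (u_l ⊗ ⋯ ⊗ u_1)`. -/
def leftMul (Φ : PreNat F G n) {l : ℕ} {X : Fin (l + 2) → C.Obj} {m : Fin (l + 1) → ℤ} {N : ℤ}
    (hN : ∑ i, m i + (n + 1) - (l + 1 : ℕ) = N) (u : C.Chain X m) :
    D.Hom (F.obj (X 0)) (G.obj (X (Fin.last (l + 1)))) N :=
  D.comp (X := F.obj (X 0)) (Y := G.obj (X (Fin.last l).castSucc))
    (Z := G.obj (X (Fin.last (l + 1)))) (m := m (Fin.last l)) (n := N - m (Fin.last l)) (by omega)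
    (G.map (u (Fin.last l)))
    (Φ.app l (fun j => X j.castSucc) (fun j => m j.castSucc)
      (by rw [Fin.sum_univ_castSucc] at hN; push_cast at hN; omega) fun j => u j.castSucc)

/-- `Φ^l (u_{l+1} ⊗ ⋯ ⊗ u_2) F (u_1)`. -/
def rightMul (Φ : PreNat F G n) {l : ℕ} {X : Fin (l + 2) → C.Obj} {m : Fin (l + 1) → ℤ} {N : ℤ}
    (hN : ∑ i, m i + (n + 1) - (l + 1 : ℕ) = N) (u : C.Chain X m) :
    D.Hom (F.obj (X 0)) (G.obj (X (Fin.last (l + 1)))) N :=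
  D.comp (X := F.obj (X 0)) (Y := F.obj (X (0 : Fin (l + 1)).succ))
    (Z := G.obj (X (Fin.last (l + 1)))) (m := N - m 0) (n := m 0) (by omega)
    (Φ.app l (fun j => X j.succ) (fun j => m j.succ)
      (by rw [Fin.sum_univ_succ] at hN; push_cast at hN; omega) fun j => u j.succ)
    (F.map (u 0))

/-- `Φ^l (u_l ⊗ ⋯ ⊗ d u_i ⊗ ⋯ ⊗ u_1)`. -/
def dInner (Φ : PreNat F G n) {l : ℕ} {X : Fin (l + 1) → C.Obj} {m : Fin l → ℤ} {N : ℤ}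
    (hN : ∑ i, m i + (n + 1) - l = N) (u : C.Chain X m) (i : Fin l) :
    D.Hom (F.obj (X 0)) (G.obj (X (Fin.last l))) N :=
  Φ.app l X (DGCat.dDeg m i) (by rw [DGCat.sum_dDeg]; omega) (DGCat.dChain u i)

/-- `Φ^l (u_{l+1} ⊗ ⋯ ⊗ u_{i+1} u_i ⊗ ⋯ ⊗ u_1)`. -/
def merge (Φ : PreNat F G n) {l : ℕ} {X : Fin (l + 2) → C.Obj} {m : Fin (l + 1) → ℤ} {N : ℤ}
    (hN : ∑ i, m i + (n + 1) - (l + 1 : ℕ) = N) (u : C.Chain X m) (i : Fin l) :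
    D.Hom (F.obj (X 0)) (G.obj (X (Fin.last (l + 1)))) N :=
  D.castHom (X := F.obj (DGCat.mergeObj X i 0)) (Y := G.obj (DGCat.mergeObj X i (Fin.last l)))
    (by simp [DGCat.mergeObj]) (by rw [DGCat.mergeObj, if_neg (by simp)]; rfl) rfl
    (Φ.app l (DGCat.mergeObj X i) (DGCat.mergeDeg m i)
      (by rw [DGCat.sum_mergeDeg]; push_cast at hN; omega) (DGCat.mergeChain u i))

/-- The component `(d^∞ Φ)^l`, evaluated on a chain `u` of `l` morphisms. Indices of morphisms
start at `0` here, so that `u 0` is the `u_1` of the usual formula and `i` stands for `i + 1`. -/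
def diff (Φ : PreNat F G n) (l : ℕ) (X : Fin (l + 1) → C.Obj) (m : Fin l → ℤ) {N : ℤ}
    (hN : ∑ i, m i + (n + 1) - l = N) (u : C.Chain X m) :
    D.Hom (F.obj (X 0)) (G.obj (X (Fin.last l))) N :=
  match l, X, m, hN, u with
  | 0, _, _, hN, u => Φ.dOuter hN u
  | l + 1, _, m, hN, u =>
    Φ.dOuter hN u +
    sgn (m (Fin.last l) - 1) • Φ.leftMul hN u +
    sgn (n * m 0 - ∑ j, m j + l) • Φ.rightMul hN u +
    ∑ i : Fin (l + 1), sgn (∑ j ∈ Finset.Ioi i, m j + (l + 1) - i) • Φ.dInner hN u i +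
    ∑ i : Fin l, sgn (∑ j ∈ Finset.Ioi i.castSucc, m j + (l + 1) - i) • Φ.merge hN u i

/-- An `A_∞`-prenatural transformation of degree `0` is an `A_∞`-natural transformation if
`d^∞ Φ = 0`. -/
def IsNatural (Φ : PreNat F G 0) : Prop :=
  ∀ (l : ℕ) (X : Fin (l + 1) → C.Obj) (m : Fin l → ℤ) (N : ℤ) (hN : ∑ i, m i + (0 + 1) - l = N)
    (u : C.Chain X m), Φ.diff l X m hN u = 0

end PreNat

section
variable {𝒞 : Type*} [Category 𝒞] {U V : SimplicialObject 𝒞} {f g : U ⟶ V}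

theorem homotopy_tau (h : SimplicialObject.Homotopy g f) {k : ℕ} (i : Fin (k + 1)) :
    h.h i ≫ tau V (Nat.zero_le (k + 1)) = tau U (Nat.zero_le k) ≫ f.app (op ⦋0⦌) := by
  induction k with
  | zero =>
    rw [(Fin.fin_one_eq_zero i : i = 0), tau_succ V (Nat.zero_le 0), ← Category.assoc, h.h_zero_comp_δ_zero]
    exact (tau_app f _).symm
  | succ k ih =>
    rw [tau_succ V (Nat.zero_le (k + 1)), ← Category.assoc]
    cases i using Fin.cases with
    | zero => rw [h.h_zero_comp_δ_zero]; exact (tau_app f _).symm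
    | succ i =>
      have := h.h_succ_comp_δ_castSucc_of_lt 0 i (Fin.zero_le _)
      rw [Fin.castSucc_zero] at this
      rw [this, Category.assoc, ih, ← Category.assoc, ← tau_succ]

theorem homotopy_rho (h : SimplicialObject.Homotopy g f) {k : ℕ} (i : Fin (k + 1)) :
    h.h i ≫ rho V (Nat.zero_le (k + 1)) = rho U (Nat.zero_le k) ≫ g.app (op ⦋0⦌) := by
  induction k with
  | zero =>
    rw [(Fin.fin_one_eq_zero i : i = Fin.last 0), rho_succ V (Nat.zero_le 0), ← Category.assoc]
    refine (congrArg (· ≫ rho V (Nat.zero_le 0)) (h.h_last_comp_δ_last 0)).trans ?_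
    exact (rho_app g _).symm
  | succ k ih =>
    rw [rho_succ V (Nat.zero_le (k + 1)), ← Category.assoc]
    cases i using Fin.lastCases with
    | last => rw [h.h_last_comp_δ_last]; exact (rho_app g _).symm
    | cast i =>
      have := h.h_castSucc_comp_δ_succ_of_lt (Fin.last _) i (Fin.castSucc_lt_last i)
      rw [Fin.succ_last] at this
      rw [this, Category.assoc, ih, ← Category.assoc, ← rho_succ]
end

variable {U V : SimplicialObject RingedSp.{u}} {f g : U ⟶ V}

/-- The cochain with components `∑_{i=0}^k (-1)^i h_i^* φ^{k+1,q}` in bidegree `(k, q)`, for a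
combinatorial simplicial homotopy `h` with `∂_0 h_0 = f` and `∂_{k+1} h_k = g`. In Mathlib these
are the terms of type `SimplicialObject.Homotopy g f`, in this order. -/
def homotopySum (h : SimplicialObject.Homotopy g f) {E F : GMod (V _⦋0⦌)} {m n : ℤ} (hn : n + 1 = m) :
    Cochain E F m →+ Cochain (gpull (f.app (op ⦋0⦌)) E) (gpull (g.app (op ⦋0⦌)) F) n :=
  AddMonoidHom.mk' (fun φ x => ∑ i : Fin (x.k + 1), sgn i •
    gsq (h.h i) (homotopy_tau h i) (homotopy_rho h i)
      (φ ⟨x.k + 1, x.q, by have := x.eq; push_cast; omega⟩)) fun φ φ' => by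
    funext x
    refine Eq.trans ?_ Finset.sum_add_distrib
    refine Finset.sum_congr rfl fun i _ => ?_
    rw [← smul_add, ← map_add]
    rfl

/-- `Φ₀(E, a)^{k,-k} = ∑_i (-1)^i h_i^* a^{k+1,-k}`. -/
def Phi0 (h : SimplicialObject.Homotopy g f) (A : (Tw V).Obj) :
    (Tw U).Hom ((pullback f).obj A) ((pullback g).obj A) 0 :=
  homotopySum h (zero_add 1) A.a

/-- `Φ₁(φ)^{k,m-1-k} = (-1)^{m-1} ∑_i (-1)^i h_i^* φ^{k+1,m-1-k}` for `φ` of degree `m`. -/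
def Phi1 (h : SimplicialObject.Homotopy g f) {A B : (Tw V).Obj} {m n : ℤ} (hn : n + 1 = m) :
    (Tw V).Hom A B m →+ (Tw U).Hom ((pullback f).obj A) ((pullback g).obj B) n :=
  sgn (m - 1) • homotopySum h hn

/-- The `A_∞`-prenatural transformation `Φ = {Φ₀, Φ₁, 0, 0, …} : f^* ⇒ g^*`. -/
def homotopyPreNat (h : SimplicialObject.Homotopy g f) : PreNat (pullback f) (pullback g) 0 where
  app l X m N hN :=
    match l, X, m, hN with
    | 0, X, m, hN =>
      MultilinearMap.constOfIsEmpty ℤ _ ((Tw U).castHom rfl rfl (by simpa using hN) (Phi0 h (X 0)))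
    | 1, X, m, hN =>
      { toFun := fun u => Phi1 h (by simp at hN; omega) (u 0)
        map_update_add' := by
          intro _ u i x y
          obtain rfl := Subsingleton.elim i 0
          simp
        map_update_smul' := by
          intro _ u i c x
          obtain rfl := Subsingleton.elim i 0
          simp }
    | _ + 2, _, _, _ => 0
end TwistedComplex

end

/-! Write H for `homotopySum`: H(u)^{k,q} = ∑ (-1)^i h_i^* u^{k+1,q}, an operator lowering total
degree by one. The theorem is a formal consequence of two identities: H(u · v) = H(u) · f^*v +
(-1)^{|u|} g^*u · H(v) (`homotopySum_comp`) and H δ = -δ H (`homotopySum_delta`).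

For the first, think of h_i as the i-th (k+1)-simplex of the prism on a k-simplex: its vertices 0,
…, i lie on the g-side and i+1, …, k+1 on the f-side. A summand of u · v cuts this simplex at a
vertex p into a front and a back face. If p ≤ i, the front lies on the g-side and the back is the
prism simplex h_{i-p}; if i < p, the front is the prism simplex h_i and the back lies on the f-side.
So each pair (i, p) contributes to exactly one of the two terms on the right (`sum_prism_split`,
`gsq_homotopy_comp_of_le`, `gsq_homotopy_comp_of_lt`).

The second is the classical prism argument. The common walls ∂_{j+1} h_{j+1} = ∂_{j+1} h_j occur
twice with opposite signs and cancel; any other inner face passes through the homotopy with one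
index shifted by one, which produces the minus sign (`sum_prism_cancel`). Since δ omits the outer
faces, the end terms f and g of the usual chain homotopy formula do not appear here; they enter only
through products.

Now Φ₀ = H(a) and Φ₁ = (-1)^{m-1} H. In arity 0 the equation is H applied to δa + a · a = 0
(`tw_Phi0`); in arity 1 it is H applied to dφ = δφ + b · φ - (-1)^m φ · a (`tw_Phi1`); in arity 2 it
is the derivation rule with signs adjusted (`Phi1_comp`). From arity 3 on, only components of arity
at least 2 occur, and these are zero. -/

namespace TwistedComplex

/-! ### Reindexing double sums over the prism -/

section Sums
variable {M : Type*}

/-- The rectangle is cut along the diagonal. Pairs with i < p are recorded with p lowered by one,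
pairs with p ≤ i with i replaced by its excess over p, so both halves are indexed by the same range
of p. -/
theorem sum_range_prism_split [AddCommMonoid M] (k : ℕ) (T : ℕ → ℕ → M) :
    ∑ i ∈ Finset.range (k + 1), ∑ p ∈ Finset.range (k + 2), T i p =
      ∑ p ∈ Finset.range (k + 1), (∑ i ∈ Finset.range (p + 1), T i (p + 1) +
        ∑ i ∈ Finset.range (k - p + 1), T (p + i) p) := by
  rw [Finset.sum_add_distrib, Finset.sum_sigma', Finset.sum_sigma', Finset.sum_sigma',
    ← Finset.sum_filter_add_sum_filter_not _ (fun x => x.1 < x.2)]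
  congr 1
  · refine Finset.sum_bij' (fun x _ => ⟨x.2 - 1, x.1⟩) (fun x _ => ⟨x.2, x.1 + 1⟩) ?_ ?_ ?_ ?_ ?_
    · rintro ⟨i, p⟩ h; simp at h ⊢; omega
    · rintro ⟨p, i⟩ h; simp at h ⊢; omega
    · rintro ⟨i, p⟩ h; simp at h ⊢; omega
    · rintro ⟨p, i⟩ h; simp
    · rintro ⟨i, p⟩ h
      simp at h ⊢
      rw [Nat.sub_add_cancel (by omega)]
  · refine Finset.sum_bij' (fun x _ => ⟨x.2, x.1 - x.2⟩) (fun x _ => ⟨x.1 + x.2, x.1⟩) ?_ ?_ ?_ ?_ ?_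
    · rintro ⟨i, p⟩ h; simp at h ⊢; omega
    · rintro ⟨p, i⟩ h; simp at h ⊢; omega
    · rintro ⟨i, p⟩ h; simp at h ⊢; omega
    · rintro ⟨p, i⟩ h; simp
    · rintro ⟨i, p⟩ h
      simp at h ⊢
      rw [Nat.add_sub_cancel' (by omega)]

theorem sum_prism_split [AddCommMonoid M] (k : ℕ) (T : Fin (k + 1) → Fin (k + 2) → M) :
    ∑ i, ∑ p, T i p =
      ∑ p : Fin (k + 1), ∑ i : Fin (p + 1), T ⟨i, by omega⟩ p.succ +
        ∑ p : Fin (k + 1), ∑ i : Fin (k - p + 1), T ⟨p + i, by omega⟩ p.castSucc := by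
  -- Extension by zero makes the natural-number version applicable; only indices inside the
  -- rectangle occur, so the default value is never seen.
  let T' : ℕ → ℕ → M := fun i p =>
    if h : i < k + 1 ∧ p < k + 2 then T ⟨i, h.1⟩ ⟨p, h.2⟩ else 0
  have hT : ∀ (i : Fin (k + 1)) (p : Fin (k + 2)), T i p = T' i p := fun i p => by
    rw [show T' i p = _ from dif_pos ⟨i.2, p.2⟩]
  simp only [hT]
  have := sum_range_prism_split k T'
  simp only [Finset.sum_add_distrib, Finset.sum_range] at this
  exact this

/-- Here `A i j` stands for the signed term with h_i and the inner face ∂_{j+1}. Entries on the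
diagonal cancel against those just beside it; deleting both leaves a smaller rectangle, reached by
lowering i on one side and j on the other. -/
theorem sum_range_prism_cancel [AddCommGroup M] (k : ℕ) (A B : ℕ → ℕ → M)
    (h₀ : ∀ j < k + 1, A (j + 1) j + A j j = 0)
    (h₁ : ∀ i j, j < i → i < k + 1 → A (i + 1) j = B i j)
    (h₂ : ∀ i j, i ≤ j → j < k → A i (j + 1) = B i j) :
    ∑ i ∈ Finset.range (k + 2), ∑ j ∈ Finset.range (k + 1), A i j =
      ∑ i ∈ Finset.range (k + 1), ∑ j ∈ Finset.range k, B i j := by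
  rw [Finset.sum_comm, sum_range_prism_split k fun j i => A i j]
  refine Finset.sum_congr rfl fun p hp => ?_
  have hp : p < k + 1 := Finset.mem_range.1 hp
  have e : ∑ j ∈ Finset.range k, B p j =
      ∑ j ∈ Finset.range p, B p j + ∑ j ∈ Finset.range (k - p), B p (p + j) := by
    rw [← Finset.sum_range_add, Nat.add_sub_cancel' (by omega)]
  -- For fixed p, the last term of the first block is `A (p + 1) p` and the first term of the second
  -- block is `A p p`; peeling them off exposes the pair killed by `h₀`. The remaining terms are the
  -- row `B p`, cut at column p.
  rw [e, Finset.sum_range_succ, Finset.sum_range_succ', ← Finset.sum_congr rfl fun j hj =>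
    h₁ p j (Finset.mem_range.1 hj) hp, ← Finset.sum_congr rfl fun j hj =>
    h₂ p (p + j) (by omega) (by have := Finset.mem_range.1 hj; omega)]
  have := h₀ p hp
  rw [add_zero, add_assoc, add_comm (Finset.sum (Finset.range (k - p)) _), ← add_assoc (A (p + 1) p),
    this, zero_add]
  rfl

theorem sum_prism_cancel [AddCommGroup M] (k : ℕ) (A : Fin (k + 2) → Fin (k + 1) → M)
    (B : Fin (k + 1) → Fin k → M)
    (h₀ : ∀ j : Fin (k + 1), A j.succ j + A j.castSucc j = 0)
    (h₁ : ∀ (i : Fin (k + 1)) (j : Fin k), (j : ℕ) < i → A i.succ j.castSucc = B i j)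
    (h₂ : ∀ (i : Fin (k + 1)) (j : Fin k), (i : ℕ) ≤ j → A i.castSucc j.succ = B i j) :
    ∑ i, ∑ j, A i j = ∑ i, ∑ j, B i j := by
  let A' : ℕ → ℕ → M := fun i j =>
    if h : i < k + 2 ∧ j < k + 1 then A ⟨i, h.1⟩ ⟨j, h.2⟩ else 0
  let B' : ℕ → ℕ → M := fun i j =>
    if h : i < k + 1 ∧ j < k then B ⟨i, h.1⟩ ⟨j, h.2⟩ else 0
  have hA : ∀ (i : Fin (k + 2)) (j : Fin (k + 1)), A i j = A' i j := fun i j => by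
    rw [show A' i j = _ from dif_pos ⟨i.2, j.2⟩]
  have hB : ∀ (i : Fin (k + 1)) (j : Fin k), B i j = B' i j := fun i j => by
    rw [show B' i j = _ from dif_pos ⟨i.2, j.2⟩]
  simp only [hA, hB] at h₀ h₁ h₂ ⊢
  have := sum_range_prism_cancel k A' B' (fun j hj => h₀ ⟨j, hj⟩)
    (fun i j hji hi => h₁ ⟨i, hi⟩ ⟨j, by omega⟩ hji)
    (fun i j hij hj => h₂ ⟨i, by omega⟩ ⟨j, hj⟩ hij)
  simpa only [Finset.sum_range] using this
end Sums

/-! ### Front and back faces of the prism simplices -/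

section
variable {𝒞 : Type*} [Category 𝒞] {U V : SimplicialObject 𝒞} {f g : U ⟶ V}

/-- The first p + 1 vertices of h_i all lie on the g-side when p ≤ i. Removing last vertices one at
a time commutes with h_i until h_i is itself the last prism simplex; there the last face is g and
naturality finishes. -/
theorem homotopy_rho_of_le (h : SimplicialObject.Homotopy g f) {p k : ℕ} (hk : p ≤ k)
    (hk' : p ≤ k + 1) (i : Fin (k + 1)) (hi : p ≤ i) :
    h.h i ≫ rho V hk' = rho U hk ≫ g.app (op ⦋p⦌) := by
  induction k with
  | zero =>
    obtain rfl : p = 0 := by omega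
    exact homotopy_rho h i
  | succ k ih =>
    rw [rho_succ V hk, ← Category.assoc]
    cases i using Fin.lastCases with
    | last => rw [h.h_last_comp_δ_last]; exact (rho_app g _).symm
    | cast i =>
      have hpk : p ≤ k := by have := i.2; simp at hi; omega
      have := h.h_castSucc_comp_δ_succ_of_lt (Fin.last _) i (Fin.castSucc_lt_last i)
      rw [Fin.succ_last] at this
      rw [this, Category.assoc, ih hpk hk i hi, ← Category.assoc, ← rho_succ]

/-- With i ≤ p the front face still contains the step from the g-side to the f-side, and removing
vertices behind it does not change the index i. -/
theorem homotopy_rho_of_lt (h : SimplicialObject.Homotopy g f) {p k : ℕ} (hk : p ≤ k)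
    (hk' : p + 1 ≤ k + 1) (i : Fin (k + 1)) (i' : Fin (p + 1)) (hi : (i : ℕ) = i') :
    h.h i ≫ rho V hk' = rho U hk ≫ h.h i' := by
  induction k, hk using Nat.le_induction with
  | base =>
    obtain rfl : i = i' := Fin.ext hi
    rw [rho_self, rho_self, Category.id_comp, Category.comp_id]
  | succ k hk ih =>
    have hk₁ : p + 1 ≤ k + 1 := by omega
    -- Since i ≤ p ≤ k, the index i is not the last one, so the last face passes through h_i.
    obtain ⟨j, rfl⟩ : ∃ j : Fin (k + 1), i = j.castSucc := ⟨⟨i, by omega⟩, rfl⟩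
    have := h.h_castSucc_comp_δ_succ_of_lt (Fin.last _) j (Fin.castSucc_lt_last j)
    rw [Fin.succ_last] at this
    rw [rho_succ V hk₁, ← Category.assoc, this, Category.assoc, ih hk₁ j hi, ← Category.assoc,
      ← rho_succ]

/-- The last r + 1 vertices have index at least i + 1, hence lie on the f-side. Each ∂_0 lowers the
index of h by one, until ∂_0 h_0 = f is reached. -/
theorem homotopy_tau_of_lt (h : SimplicialObject.Homotopy g f) {r k : ℕ} (hk : r ≤ k)
    (hk' : r ≤ k + 1) (i : Fin (k + 1)) (hi : i + r ≤ k) :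
    h.h i ≫ tau V hk' = tau U hk ≫ f.app (op ⦋r⦌) := by
  induction k with
  | zero =>
    obtain rfl : r = 0 := by omega
    exact homotopy_tau h i
  | succ k ih =>
    rw [tau_succ V hk, ← Category.assoc]
    cases i using Fin.cases with
    | zero => rw [h.h_zero_comp_δ_zero]; exact (tau_app f _).symm
    | succ i =>
      have hi' : (i : ℕ) + r ≤ k := by simp at hi; omega
      have hrk : r ≤ k := by omega
      have := h.h_succ_comp_δ_castSucc_of_lt 0 i (Fin.zero_le _)
      rw [Fin.castSucc_zero] at this
      rw [this, Category.assoc, ih hrk hk i hi', ← Category.assoc, ← tau_succ]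

/-- Dropping the first k - r vertices, all strictly before the step of the prism, renumbers that
step as i' = i - (k - r). -/
theorem homotopy_tau_of_le (h : SimplicialObject.Homotopy g f) {r k : ℕ} (hk : r ≤ k)
    (hk' : r + 1 ≤ k + 1) (i : Fin (k + 1)) (i' : Fin (r + 1)) (hi : i + r = k + i') :
    h.h i ≫ tau V hk' = tau U hk ≫ h.h i' := by
  induction k, hk using Nat.le_induction with
  | base =>
    obtain rfl : i = i' := Fin.ext (by omega)
    rw [tau_self, tau_self, Category.id_comp, Category.comp_id]
  | succ k hk ih =>
    have hk₁ : r + 1 ≤ k + 1 := by omega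
    -- The relation i + r = k + 1 + i' with r ≤ k forces i to be positive, so ∂_0 h_i is again of
    -- the form h_{i-1} ∂_0.
    obtain ⟨j, rfl⟩ : ∃ j : Fin (k + 1), i = j.succ :=
      ⟨⟨i - 1, by omega⟩, Fin.ext (by simp; omega)⟩
    have := h.h_succ_comp_δ_castSucc_of_lt 0 j (Fin.zero_le _)
    rw [Fin.castSucc_zero] at this
    rw [tau_succ V hk₁, ← Category.assoc, this, Category.assoc, ih hk₁ j (by simp at hi; omega),
      ← Category.assoc, ← tau_succ]
end

variable {U V : SimplicialObject RingedSp.{u}} {f g : U ⟶ V}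

theorem homotopySum_apply (h : SimplicialObject.Homotopy g f) {E F : GMod (V _⦋0⦌)} {m n : ℤ}
    (hn : n + 1 = m) (φ : Cochain E F m) (k : ℕ) (q : ℤ) (hq : (k : ℤ) + q = n) :
    homotopySum h hn φ ⟨k, q, hq⟩ = ∑ i : Fin (k + 1), sgn i •
      gsq (h.h i) (homotopy_tau h i) (homotopy_rho h i)
        (φ ⟨k + 1, q, by push_cast; omega⟩) := rfl

/-! ### The derivation rule for the homotopy operator -/

section Comp
variable {E F G : GMod (V _⦋0⦌)}

/-- The case where the cut vertex p lies on the g-side: the front factor only sees g, the back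
factor carries the prism. -/
theorem gsq_homotopy_comp_of_le (h : SimplicialObject.Homotopy g f) {p r k : ℕ} (hk : p + r = k)
    (hk' : p + (r + 1) = k + 1) {q s t : ℤ} (e : q + s = t)
    (x : GHom (gpull (tau V (Nat.zero_le p)) F) (gpull (rho V (Nat.zero_le p)) G) q)
    (y : GHom (gpull (tau V (Nat.zero_le (r + 1))) E) (gpull (rho V (Nat.zero_le (r + 1))) F) s)
    (i : Fin (k + 1)) (i' : Fin (r + 1)) (hi : (i : ℕ) = p + i') :
    gsq (h.h i) (homotopy_tau h i) (homotopy_rho h i)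
        ((Cochain.rhoPull hk' x).comp (Cochain.tauPull hk' y) e) =
      (Cochain.rhoPull hk (gsq (g.app (op ⦋p⦌)) (tau_app g _).symm (rho_app g _).symm x)).comp
        (Cochain.tauPull hk (gsq (h.h i') (homotopy_tau h i') (homotopy_rho h i') y)) e := by
  have e₁ : h.h i ≫ rho V (Nat.le.intro hk') = rho U (Nat.le.intro hk) ≫ g.app (op ⦋p⦌) :=
    homotopy_rho_of_le h _ _ i (by omega)
  have e₂ : h.h i ≫ tau V (Nat.le.intro ((add_comm (r + 1) p).trans hk')) =
      tau U (Nat.le.intro ((add_comm r p).trans hk)) ≫ h.h i' :=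
    homotopy_tau_of_le h _ _ i i' (by omega)
  -- The sheaf in the middle of the composite sits at the cut vertex and is therefore pulled back
  -- along g; this is what makes the two pulled-back factors composable.
  have hb : h.h i ≫ rho V (Nat.le.intro hk') ≫ tau V (Nat.zero_le p) =
      (rho U (Nat.le.intro hk) ≫ tau U (Nat.zero_le p)) ≫ g.app (op ⦋0⦌) := by
    rw [← Category.assoc, e₁, Category.assoc, Category.assoc, tau_app]
  rw [gsq_comp _ hb]
  exact congr_arg₂ (fun x y => GHom.comp x y e) (gsq_gres_comm e₁ _) (gsq_gres_comm e₂ _)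

/-- The case where the cut vertex p + 1 lies on the f-side: the front factor carries the prism, the
back factor and the middle sheaf only see f. -/
theorem gsq_homotopy_comp_of_lt (h : SimplicialObject.Homotopy g f) {p r k : ℕ} (hk : p + r = k)
    (hk' : p + 1 + r = k + 1) {q s t : ℤ} (e : q + s = t)
    (x : GHom (gpull (tau V (Nat.zero_le (p + 1))) F) (gpull (rho V (Nat.zero_le (p + 1))) G) q)
    (y : GHom (gpull (tau V (Nat.zero_le r)) E) (gpull (rho V (Nat.zero_le r)) F) s)
    (i : Fin (k + 1)) (i' : Fin (p + 1)) (hi : (i : ℕ) = i') :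
    gsq (h.h i) (homotopy_tau h i) (homotopy_rho h i)
        ((Cochain.rhoPull hk' x).comp (Cochain.tauPull hk' y) e) =
      (Cochain.rhoPull hk (gsq (h.h i') (homotopy_tau h i') (homotopy_rho h i') x)).comp
        (Cochain.tauPull hk (gsq (f.app (op ⦋r⦌)) (tau_app f _).symm (rho_app f _).symm y)) e := by
  have e₁ : h.h i ≫ rho V (Nat.le.intro hk') = rho U (Nat.le.intro hk) ≫ h.h i' :=
    homotopy_rho_of_lt h _ _ i i' hi
  have e₂ : h.h i ≫ tau V (Nat.le.intro ((add_comm r (p + 1)).trans hk')) =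
      tau U (Nat.le.intro ((add_comm r p).trans hk)) ≫ f.app (op ⦋r⦌) :=
    homotopy_tau_of_lt h _ _ i (by omega)
  have hb : h.h i ≫ rho V (Nat.le.intro hk') ≫ tau V (Nat.zero_le (p + 1)) =
      (rho U (Nat.le.intro hk) ≫ tau U (Nat.zero_le p)) ≫ f.app (op ⦋0⦌) := by
    rw [← Category.assoc, e₁, Category.assoc, Category.assoc, homotopy_tau]
  rw [gsq_comp _ hb]
  exact congr_arg₂ (fun x y => GHom.comp x y e) (gsq_gres_comm e₁ _) (gsq_gres_comm e₂ _)

/-- `homotopySum` is a derivation along `f^*` and `g^*`. -/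
theorem homotopySum_comp (h : SimplicialObject.Homotopy g f) {m m' l n n' N : ℤ} (hl : m + m' = l)
    (hn : n + 1 = m) (hn' : n' + 1 = m') (hN : N + 1 = l) (h₁ : n + m' = N) (h₂ : m + n' = N)
    (u : Cochain F G m) (v : Cochain E F m') :
    homotopySum h hN (u.comp v hl) = (homotopySum h hn u).comp (Cochain.map f v) h₁ +
      sgn m • (Cochain.map g u).comp (homotopySum h hn' v) h₂ := by
  subst hn hn'
  refine Cochain.ext fun k t ht => ?_
  have L : homotopySum h hN (u.comp v hl) ⟨k, t, ht⟩ = ∑ i : Fin (k + 1), ∑ p : Fin (k + 2),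
      sgn i • gsq (h.h i) (homotopy_tau h i) (homotopy_rho h i)
        (Cochain.term u v (k + 1) p (k + 1 - p) (by omega) t (by push_cast; omega)) := by
    rw [homotopySum_apply]
    refine Finset.sum_congr rfl fun i _ => ?_
    rw [← Finset.smul_sum, ← map_sum]
    rfl
  rw [L, sum_prism_split, Cochain.add_apply, Cochain.smul_apply]
  refine congr_arg₂ (· + ·) ?_ ?_
  · change _ = ∑ p : Fin (k + 1), _
    refine Finset.sum_congr rfl fun p _ => ?_
    have hp : (p : ℕ) + (k - p) = k := by omega
    have hp' : (p : ℕ) + 1 + (k - p) = k + 1 := by omega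
    have hs : ((k - p : ℕ) : ℤ) + (n' + 1 - (k - p : ℕ)) = n' + 1 := by omega
    -- Passing from u^{p+1,q} to H(u)^{p,q} keeps the internal degree q = n - p, so the sign
    -- (-1)^{qr} is the same on both sides and the first term needs no extra sign.
    rw [Cochain.term_eq _ _ _ _ (q := n - p) (s := n' + 1 - (k - p : ℕ)) (by omega) hs,
      homotopySum_apply, map_sum]
    simp only [map_zsmul]
    rw [Cochain.GHom_sum_comp, Finset.smul_sum]
    refine Finset.sum_congr rfl fun i _ => ?_
    have T : Cochain.term u v (k + 1) p.succ (k + 1 - p.succ) (by omega) t (by push_cast; omega) = _ :=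
      (Cochain.term_congr u v rfl (by simp) _ hp' _).trans
        (Cochain.term_eq u v hp' (by push_cast; omega) (q := n - p) (by push_cast; omega) hs)
    rw [T, map_zsmul, smul_smul, smul_smul]
    refine congr_arg₂ (· • ·) (mul_comm _ _) ?_
    exact gsq_homotopy_comp_of_lt h hp hp' _ _ _ _ i rfl
  · change _ = sgn _ • ∑ p : Fin (k + 1), _
    rw [Finset.smul_sum]
    refine Finset.sum_congr rfl fun p _ => ?_
    have hp : (p : ℕ) + (k - p) = k := by omega
    have hp' : (p : ℕ) + (k - p + 1) = k + 1 := by omega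
    have hq : (p : ℤ) + (n + 1 - p) = n + 1 := by omega
    have hs : ((k - p : ℕ) : ℤ) + (n' - (k - p : ℕ)) = n' := by omega
    rw [Cochain.term_eq _ _ _ _ hq hs,
      homotopySum_apply, map_sum]
    simp only [map_zsmul]
    rw [Cochain.GHom_comp_sum, Finset.smul_sum, Finset.smul_sum]
    refine Finset.sum_congr rfl fun i _ => ?_
    have T : Cochain.term u v (k + 1) p.castSucc (k + 1 - p.castSucc) (by omega) t
        (by push_cast; omega) = _ :=
      (Cochain.term_congr u v rfl (by simp; omega) _ hp' _).trans
        (Cochain.term_eq u v hp' (by push_cast; omega) hq (s := n' - (k - p : ℕ))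
          (by push_cast; omega))
    rw [T, map_zsmul, smul_smul, smul_smul, smul_smul]
    refine congr_arg₂ (· • ·) ?_ (gsq_homotopy_comp_of_le h hp hp' _ _ _ _ i rfl)
    -- The exponents agree because p + i + q(r + 1) = (p + q) + qr + i, and p + q is the degree of
    -- `u`: this is the source of the factor (-1)^{|u|}.
    rw [← sgn_add, ← sgn_add, ← sgn_add]
    congr 1
    push_cast
    ring
end Comp

/-! ### Anticommutation with δ -/

theorem gsq_homotopy_face (h : SimplicialObject.Homotopy g f) {E F : GMod (V _⦋0⦌)} {k : ℕ}
    (i : Fin (k + 2)) (j : Fin (k + 1)) (i' : Fin (k + 1)) (j' : Fin k)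
    (e : h.h i ≫ V.δ j.succ.castSucc = U.δ j'.succ.castSucc ≫ h.h i') {q : ℤ}
    (x : GHom (gpull (tau V (Nat.zero_le (k + 1))) E) (gpull (rho V (Nat.zero_le (k + 1))) F) q) :
    gsq (h.h i) (homotopy_tau h i) (homotopy_rho h i) (Cochain.face j x) =
      Cochain.face j' (gsq (h.h i') (homotopy_tau h i') (homotopy_rho h i') x) :=
  gsq_gres_comm e x

/-- Consecutive prism simplices share the wall ∂_{j+1} h_{j+1} = ∂_{j+1} h_j, so both pullbacks are
taken along the same composite map. -/
theorem gsq_homotopy_face_self (h : SimplicialObject.Homotopy g f) {E F : GMod (V _⦋0⦌)} {k : ℕ}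
    (j : Fin (k + 1)) {q : ℤ}
    (x : GHom (gpull (tau V (Nat.zero_le (k + 1))) E) (gpull (rho V (Nat.zero_le (k + 1))) F) q) :
    gsq (h.h j.succ) (homotopy_tau h _) (homotopy_rho h _) (Cochain.face j x) =
      gsq (h.h j.castSucc) (homotopy_tau h _) (homotopy_rho h _) (Cochain.face j x) := by
  have e : h.h j.succ ≫ V.δ j.succ.castSucc = h.h j.castSucc ≫ V.δ j.succ.castSucc :=
    h.h_succ_comp_δ_castSucc_succ j
  have ha : (h.h j.castSucc ≫ V.δ j.succ.castSucc) ≫ tau V (Nat.zero_le (k + 1)) =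
      tau U (Nat.zero_le (k + 1)) ≫ f.app (op ⦋0⦌) := by
    rw [Category.assoc, delta_tau_zero _ _ (by simp; omega), homotopy_tau]
  have hb : (h.h j.castSucc ≫ V.δ j.succ.castSucc) ≫ rho V (Nat.zero_le (k + 1)) =
      rho U (Nat.zero_le (k + 1)) ≫ g.app (op ⦋0⦌) := by
    rw [Category.assoc, delta_rho_zero _ _ (by simp), homotopy_rho]
  unfold Cochain.face
  rw [gsq_gres _ _ _ _ e ha hb, gsq_gres _ _ _ _ rfl ha hb]

theorem homotopySum_delta (h : SimplicialObject.Homotopy g f) {E F : GMod (V _⦋0⦌)} {m n l : ℤ}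
    (hn : n + 1 = m) (hl : m + 1 = l) (u : Cochain E F m) :
    homotopySum h hl (Cochain.delta hl u) = -Cochain.delta hn (homotopySum h hn u) := by
  subst hn hl
  refine Cochain.ext fun k q hq => ?_
  have L : Cochain.delta rfl u ⟨k + 1, q, by push_cast; omega⟩ =
      ∑ j : Fin k, sgn ((j : ℤ) + 1) • Cochain.face j (u ⟨k, q, hq⟩) := rfl
  rw [homotopySum_apply]
  -- In simplicial degree 0 both sides vanish: a 1-simplex has no inner face, and δ has no component
  -- in degree 0.
  cases k with
  | zero =>
    refine (Fin.sum_univ_one _).trans ?_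
    rw [L, Finset.univ_eq_empty, Finset.sum_empty, map_zero, smul_zero]
    exact neg_zero.symm
  | succ k =>
    have R : (-Cochain.delta rfl (homotopySum h rfl u)) ⟨k + 1, q, hq⟩ =
        ∑ i : Fin (k + 1), ∑ j : Fin k, -(sgn i * sgn (j + 1)) • Cochain.face j
          (gsq (h.h i) (homotopy_tau h i) (homotopy_rho h i) (u ⟨k + 1, q, hq⟩)) := by
      change -(Cochain.delta rfl (homotopySum h rfl u) ⟨k + 1, q, hq⟩) = _
      rw [Cochain.delta_succ, Finset.sum_comm, ← Finset.sum_neg_distrib]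
      refine Finset.sum_congr rfl fun j _ => ?_
      rw [homotopySum_apply, map_sum, Finset.smul_sum, ← Finset.sum_neg_distrib]
      refine Finset.sum_congr rfl fun i _ => ?_
      rw [map_zsmul, smul_smul, mul_comm, ← neg_smul]
      rfl
    rw [R]
    refine (Finset.sum_congr rfl fun i _ => ?_).trans (sum_prism_cancel k
      (fun i j => (sgn i * sgn (j + 1)) • gsq (h.h i) (homotopy_tau h i) (homotopy_rho h i)
        (Cochain.face j (u ⟨k + 1, q, hq⟩))) _ ?_ ?_ ?_)
    · rw [L, map_sum, Finset.smul_sum]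
      refine Finset.sum_congr rfl fun j _ => ?_
      rw [map_zsmul, smul_smul]
    -- The shared wall appears with the signs (-1)^{j+1} and (-1)^j of the two prism simplices,
    -- hence cancels.
    · intro j
      dsimp only
      rw [gsq_homotopy_face_self, ← add_smul, Fin.val_succ, Fin.val_castSucc]
      push_cast
      rw [sgn_succ, neg_mul, neg_add_cancel, zero_smul]
    -- Here ∂_{j+1} h_{i+1} = h_i ∂_{j+1} for j < i: lowering the prism index by one costs the sign.
    · intro i j hij
      dsimp only
      rw [gsq_homotopy_face h i.succ j.castSucc i j
        (h.h_succ_comp_δ_castSucc_of_lt j.castSucc.succ i (by simp [Fin.le_def]; omega)),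
        Fin.val_succ, Fin.val_castSucc]
      push_cast
      rw [sgn_succ, neg_mul]
    -- Here ∂_{j+2} h_i = h_i ∂_{j+1} for i ≤ j: now the face index drops by one and costs the sign.
    · intro i j hij
      dsimp only
      rw [gsq_homotopy_face h i.castSucc j.succ i j
        (h.h_castSucc_comp_δ_succ_of_lt j.castSucc.succ i (by simp [Fin.lt_def]; omega)),
        Fin.val_succ, Fin.val_castSucc]
      push_cast
      rw [sgn_succ ((j : ℤ) + 1), mul_neg]

/-! ### Signs and transport along equalities of degrees -/

theorem sgn_sub_one (m : ℤ) : sgn (m - 1) = -sgn m := by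
  rw [← sub_add_cancel m 1, sgn_succ, add_sub_cancel_right, neg_neg]

theorem sgn_neg (m : ℤ) : sgn (-m) = sgn m := sgn_congr ⟨-m, by ring⟩

namespace DGCat
variable {C : DGCat.{u}} {X X' Y Y' Z : C.Obj}

theorem castHom_zero {m m' : ℤ} (hX : X = X') (hY : Y = Y') (hm : m = m') :
    C.castHom hX hY hm (0 : C.Hom X Y m) = 0 := by
  subst hX hY hm; rfl

theorem d_castHom {m m' n : ℤ} (hm : m = m') (h : m' + 1 = n) (h' : m + 1 = n) (u : C.Hom X Y m) :
    C.d h (C.castHom rfl rfl hm u) = C.d h' u := by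
  subst hm; rfl

theorem comp_castHom {m n n' l : ℤ} (hn : n = n') (h : m + n' = l) (h' : m + n = l)
    (u : C.Hom Y Z m) (v : C.Hom X Y n) :
    C.comp h u (C.castHom rfl rfl hn v) = C.comp h' u v := by
  subst hn; rfl

theorem castHom_comp {m m' n l : ℤ} (hm : m = m') (h : m' + n = l) (h' : m + n = l)
    (u : C.Hom Y Z m) (v : C.Hom X Y n) :
    C.comp h (C.castHom rfl rfl hm u) v = C.comp h' u v := by
  subst hm; rfl
end DGCat

/-! ### The identities satisfied by Φ₀ and Φ₁ -/

variable {U V : SimplicialObject RingedSp.{u}} {f g : U ⟶ V} (h : SimplicialObject.Homotopy g f)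

theorem Phi1_apply {A B : TwObj V} {m n : ℤ} (hn : n + 1 = m) (φ : Cochain A.E B.E m) :
    Phi1 h (A := A) (B := B) hn φ = sgn (m - 1) • homotopySum h hn φ := rfl

/-- Applying H to the Maurer–Cartan equation gives -δH(a) + H(a) · f^*a - g^*a · H(a) = 0, which is
the negative of the differential of H(a). -/
theorem tw_Phi0 (A : TwObj V) :
    tw (A.pullback f) (A.pullback g) (zero_add 1) (Phi0 h A) = 0 := by
  have e := congrArg (homotopySum h one_add_one_eq_two) A.maurerCartan
  rw [map_add, map_zero, homotopySum_delta h (zero_add 1),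
    homotopySum_comp h _ (zero_add 1) (zero_add 1) _ (zero_add 1) (add_zero 1), sgn_one] at e
  rw [tw_apply, sgn_zero, one_smul]
  rw [← neg_eq_zero, ← e]
  change -(Cochain.delta _ (homotopySum h _ A.a) + (Cochain.map g A.a).comp (homotopySum h _ A.a) _ -
    (homotopySum h _ A.a).comp (Cochain.map f A.a) _) = _
  rw [neg_one_smul]
  abel

/-- Expanding H(dφ) by the two identities, the terms with δ, g^*b · H(φ) and H(φ) · f^*a form the
differential of Φ₁(φ), while H(b) · f^*φ and g^*φ · H(a) are the two products with Φ₀. -/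
theorem tw_Phi1 {A B : TwObj V} {m n l N : ℤ} (hn : n + 1 = m) (hl : m + 1 = l) (hN : N + 1 = l)
    (h₁ : n + 1 = N) (h₂ : m + 0 = N) (h₃ : 0 + m = N) (u : Cochain A.E B.E m) :
    tw (A.pullback f) (B.pullback g) h₁ (Phi1 h (A := A) (B := B) hn u) +
      sgn (m - 1) • (Cochain.map g u).comp (Phi0 h A) h₂ +
      sgn m • (Phi0 h B).comp (Cochain.map f u) h₃ -
      Phi1 h (A := A) (B := B) hN (tw A B hl u) = 0 := by
  obtain rfl : m = N := hn.symm.trans h₁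
  -- The first sign comes from the differential of Φ₁(u), which has degree n = m - 1; the next one
  -- is the prefactor of Φ₁ on d u, of degree m + 1.
  have hs : sgn n = -sgn m := by rw [← hn, sgn_succ, neg_neg]
  have hl' : sgn (l - 1) = sgn m := by rw [← hl, add_sub_cancel_right]
  rw [Phi1_apply, Phi1_apply, map_zsmul, hl', sgn_sub_one, tw_apply, tw_apply, map_sub, map_add,
    map_zsmul, homotopySum_delta h hn,
    homotopySum_comp h _ (zero_add 1) hn _ (h₃) ((add_comm 1 n).trans h₁),
    homotopySum_comp h _ hn (zero_add 1) _ h₁ h₂, sgn_one, hs]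
  change _ • (Cochain.delta _ _ + (Cochain.map g B.a).comp _ _ - _ • (homotopySum h _ u).comp
    (Cochain.map f A.a) _) + _ • (Cochain.map g u).comp (homotopySum h _ A.a) _ +
    _ • (homotopySum h _ B.a).comp _ _ - _ = 0
  have := sgn_mul_self m
  simp only [smul_add, smul_sub, smul_neg, neg_smul, smul_smul, neg_mul, one_smul, this]
  abel

/-- The derivation rule after inserting (-1)^{degree - 1}: the prefactor of the composite is
-(-1)^{m+m'}. It leaves (-1)^{m'} on the first term, while on the second the (-1)^m of the rule is
absorbed. -/
theorem Phi1_comp {A B C : TwObj V} {m m' l n n' N : ℤ} (hl : m + m' = l) (hn : n + 1 = m)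
    (hn' : n' + 1 = m') (hN : N + 1 = l) (h₁ : n + m' = N) (h₂ : m + n' = N)
    (u : Cochain B.E C.E m) (v : Cochain A.E B.E m') :
    Phi1 h (A := A) (B := C) hN (u.comp v hl) =
      sgn m' • (Phi1 h (A := B) (B := C) hn u).comp (Cochain.map f v) h₁ +
        (Cochain.map g u).comp (Phi1 h (A := A) (B := B) hn' v) h₂ := by
  have hs : sgn (l - 1) = -(sgn m * sgn m') := by rw [sgn_sub_one, ← hl, sgn_add]
  rw [Phi1_apply, Phi1_apply, Phi1_apply, homotopySum_comp h hl hn hn' hN h₁ h₂, hs,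
    Cochain.smul_comp, Cochain.comp_smul, sgn_sub_one, sgn_sub_one]
  simp only [smul_add, smul_smul]
  have := sgn_mul_self m
  refine congr_arg₂ (· + ·) (congr_arg₂ (· • ·) (by ring) rfl) (congr_arg₂ (· • ·) ?_ rfl)
  linear_combination (-sgn m') * this

/-! ### Vanishing of the components of d^∞ Φ -/

theorem homotopyPreNat_diff_zero (X : Fin 1 → (Tw V).Obj) (m : Fin 0 → ℤ) (N : ℤ)
    (hN : ∑ i, m i + (0 + 1) - (0 : ℕ) = N) (u : (Tw V).Chain X m) :
    (homotopyPreNat h).diff 0 X m hN u = 0 := by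
  obtain rfl : N = 1 := by simpa using hN.symm
  -- `dOuter` takes Φ₀ in degree 1 - 1, so it is transported from degree 0; the transport disappears
  -- under the differential.
  exact (DGCat.d_castHom (C := Tw U) (sub_self 1).symm _ (zero_add 1) (Phi0 h (X 0))).trans (tw_Phi0 h (X 0))

theorem homotopyPreNat_diff_one (X : Fin 2 → (Tw V).Obj) (m : Fin 1 → ℤ) (N : ℤ)
    (hN : ∑ i, m i + (0 + 1) - (1 : ℕ) = N) (u : (Tw V).Chain X m) :
    (homotopyPreNat h).diff 1 X m hN u = 0 := by
  have hm : m 0 = N := by simpa using hN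
  have e₁ : (homotopyPreNat h).leftMul hN u =
      (Cochain.map g (u 0)).comp (Phi0 h (X 0)) ((add_zero _).trans hm) :=
    DGCat.comp_castHom (C := Tw U) _ _ ((add_zero _).trans hm) _ _
  have e₂ : (homotopyPreNat h).rightMul hN u =
      (Phi0 h (X 1)).comp (Cochain.map f (u 0)) ((zero_add _).trans hm) :=
    DGCat.castHom_comp (C := Tw U) _ _ ((zero_add _).trans hm) _ _
  have e₃ : (homotopyPreNat h).dInner hN u 0 =
      Phi1 h (congrArg (· + 1) hm.symm) ((Tw V).d rfl (u 0)) := rfl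
  have e₀ : (homotopyPreNat h).dOuter hN u = (Tw U).d (sub_add_cancel N 1)
    (Phi1 h ((sub_add_cancel N 1).trans hm.symm) (u 0)) := rfl
  change _ + _ + _ + _ + _ = _
  have s₁ : sgn (0 * m 0 - ∑ j, m j + (0 : ℕ)) = sgn (m 0) := by
    rw [Fin.sum_univ_one, zero_mul, zero_sub, Nat.cast_zero, add_zero, sgn_neg]
  -- No morphism follows the only one in the chain, so the exponent is 1.
  have s₂ : sgn (∑ j ∈ Finset.Ioi (0 : Fin 1), m j + ((0 : ℕ) + 1) - ((0 : Fin 1) : ℕ)) = -1 := by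
    rw [show Finset.Ioi (0 : Fin 1) = ∅ from rfl]
    simp [sgn_one]
  rw [s₁, Fin.sum_univ_zero, Fin.sum_univ_one (fun i => _ • _), s₂, e₀, e₁, e₂, e₃, add_zero,
    neg_one_smul, ← sub_eq_add_neg]
  exact tw_Phi1 h _ rfl _ _ _ _ (u 0)

theorem homotopyPreNat_diff_two (X : Fin 3 → (Tw V).Obj) (m : Fin 2 → ℤ) (N : ℤ)
    (hN : ∑ i, m i + (0 + 1) - (2 : ℕ) = N) (u : (Tw V).Chain X m) :
    (homotopyPreNat h).diff 2 X m hN u = 0 := by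
  have hm : m 0 + m 1 - 1 = N := by rw [← hN, Fin.sum_univ_two]; push_cast; ring
  have e₀ : (homotopyPreNat h).dOuter hN u = 0 := map_zero ((Tw U).d _)
  have e₁ : (homotopyPreNat h).leftMul hN u =
      (Cochain.map g (u 1)).comp (Phi1 h (n := N - m 1) (by omega) (u 0)) (by omega) := rfl
  have e₂ : (homotopyPreNat h).rightMul hN u =
      (Phi1 h (n := N - m 0) (by omega) (u 1)).comp (Cochain.map f (u 0)) (by omega) := rfl
  -- The terms containing Φ² vanish; what survives is the two products with Φ₁ and Φ₁ of the
  -- composite.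
  have e₃ : ∀ i, (homotopyPreNat h).dInner hN u i = 0 := fun _ => rfl
  have e₄ : (homotopyPreNat h).merge hN u 0 =
      Phi1 h (m := m 1 + m 0) (by omega) ((Tw V).comp rfl (u 1) (u 0)) := rfl
  change _ + _ + _ + _ + _ = _
  have s₂ : sgn (0 * m 0 - ∑ j, m j + (1 : ℕ)) = -(sgn (m 0) * sgn (m 1)) := by
    rw [Fin.sum_univ_two, zero_mul, zero_sub, Nat.cast_one, sgn_succ, sgn_neg, sgn_add]
  have s₄ : sgn (∑ j ∈ Finset.Ioi (Fin.castSucc (0 : Fin 1)), m j + ((1 : ℕ) + 1) -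
      ((0 : Fin 1) : ℕ)) = sgn (m 1) := by
    rw [show Finset.Ioi (Fin.castSucc (0 : Fin 1)) = {1} from rfl, Finset.sum_singleton]
    exact sgn_congr ⟨1, by simp⟩
  -- Multiplied by (-1)^{|u_2|}, where |u_2| is `m 1`, this rule produces exactly the negatives of
  -- the two product terms.
  have e := Phi1_comp h (A := X 0) (B := X 1) (C := X 2) rfl
    (by omega : (N - m 0) + 1 = m 1) (by omega : (N - m 1) + 1 = m 0) (by omega) (by omega)
    (by omega : m 1 + (N - m 1) = N) (u 1) (u 0)
  simp only [e₃, smul_zero, Finset.sum_const_zero]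
  rw [s₂, Fin.sum_univ_one (fun i => _ • _), s₄, e₀, e₁, e₂, e₄.trans e]
  change 0 + sgn (m 1 - 1) • _ + _ + 0 + _ = _
  rw [sgn_sub_one, smul_add, smul_smul, mul_comm (sgn (m 1))]
  simp only [neg_smul]
  abel

/-- The differential in arity l + 3 involves only the components of arity l + 3 and l + 2, both of
arity at least 2 and so zero. -/
theorem homotopyPreNat_diff_of_three_le (l : ℕ) (X : Fin (l + 4) → (Tw V).Obj)
    (m : Fin (l + 3) → ℤ) (N : ℤ) (hN : ∑ i, m i + (0 + 1) - (l + 3 : ℕ) = N)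
    (u : (Tw V).Chain X m) :
    (homotopyPreNat h).diff (l + 3) X m hN u = 0 := by
  have e₀ : (homotopyPreNat h).dOuter hN u = 0 := map_zero ((Tw U).d _)
  have e₁ : (homotopyPreNat h).leftMul hN u = 0 := map_zero ((Tw U).comp _ _)
  have e₂ : (homotopyPreNat h).rightMul hN u = 0 :=
    Cochain.zero_comp (sub_add_cancel N (m 0)) _
  have e₃ : ∀ i, (homotopyPreNat h).dInner hN u i = 0 := fun _ => rfl
  have e₄ : ∀ i, (homotopyPreNat h).merge hN u i = 0 := fun _ => DGCat.castHom_zero _ _ _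
  change _ + _ + _ + _ + _ = _
  simp [e₀, e₁, e₂, e₃, e₄]

end TwistedComplex

/-- For a combinatorial simplicial homotopy `h` from `f` to `g` (`∂_0 h_0 = f`, `∂_{p+1} h_p = g`),
`Φ = {Φ₀, Φ₁, 0, 0, …}` is an `A_∞`-natural transformation `f^* ⇒ g^*`. -/
theorem theorem3p10 {U V : SimplicialObject TwistedComplex.RingedSp.{u}} {f g : U ⟶ V}
    (h : SimplicialObject.Homotopy g f) :
    (TwistedComplex.homotopyPreNat h :
      TwistedComplex.PreNat (TwistedComplex.pullback f) (TwistedComplex.pullback g) 0).IsNatural := by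
  intro l X m N hN u
  match l, X, m, hN, u with
  | 0, X, m, hN, u => exact TwistedComplex.homotopyPreNat_diff_zero h X m N hN u
  | 1, X, m, hN, u => exact TwistedComplex.homotopyPreNat_diff_one h X m N hN u
  | 2, X, m, hN, u => exact TwistedComplex.homotopyPreNat_diff_two h X m N hN u
  | l + 3, X, m, hN, u => exact TwistedComplex.homotopyPreNat_diff_of_three_le h l X m N hN u
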